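/- Let $k$ be a field. A curved algebra $(A,d,w)$ over $k$ is a $\mathbb{Z}$-graded $k$-algebra $A$ with a derivation $d$ of degree $1$ and an element $w\in A^2$ (the curvature) such that $d^2(a)=wa-aw$ for all $a\in A$ and $d(w)=0$; it is a dg algebra if $w=0$. A (right) curved $A$-module is a graded right $A$-module $M$ with a differential $d$ of degree $1$ satisfying $d(ma)=d(m)a+(-1)^{|m|}m\,d(a)$ and $d^2(m)=-mw$. Curved $A$-modules form a dg category: $\mathrm{Hom}_A(M,N)^n$ consists of the $A$-linear maps of degree $n$, with differential $f\mapsto d f-(-1)^n f d$. A curved $A$-module is finitely generated twisted if its underlying graded $A$-module is isomorphic to $V\otimes A$ for a finite-dimensional graded vector space $V$. A closed morphism $f\colon M\to N$ of degree $0$ is a weak equivalence of the second kind if $\mathrm{Hom}_A(T,M)\to \mathrm{Hom}_A(T,N)$ is a quasi-isomorphism for every finitely generated twisted $T$; $M$ is cofibrant of the second kind if $0\to M$ has the left lifting property with respect to all surjective weak equivalences of the second kind; and $M$ is perfect of the second kind if it is homotopy equivalent to a direct summand of a finitely generated twisted module. Let $\mathrm{Perf}^{\mathrm{II}}(A)$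 be the full dg category of curved $A$-modules that are cofibrant and perfect of the second kind. For a curved algebra $B$ and $x\in B^1$ let $B^x=(B,\ d+[x,-],\ w_B+dx+x^2)$ denote the twist of $B$ by $x$, where $[x,b]=xb-(-1)^{|b|}bx$. The tensor product of curved algebras is formed with the Koszul sign rule, with differential $d\otimes 1+1\otimes d$ and curvature $w\otimes 1+1\otimes w$. Let $A$ be a curved algebra with curvature $w$, and let $$x_w=\begin{pmatrix}0&-1\\ w&0\end{pmatrix}\in \bigl(A\otimes \mathrm{End}(k\oplus k[1])\bigr)^1 ,\qquad A'=\bigl(A\otimes \mathrm{End}(k\oplus k[1])\bigr)^{x_w}.$$ Then $A'$ is a dg algebra, i.e. its curvature vanishes; there is a dg functor $\mathrm{Perf}^{\mathrm{II}}(A)\to \mathrm{Perf}^{\mathrm{II}}(A')$ that is a quasi-equivalence; and $A'$ is acyclic, i.e. $H^i(A')=0$ for all $i$. -/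

import Mathlib

open scoped TensorProduct DirectSum

universe u

noncomputable section

/-- A curved algebra `(A, d, w)` over a field `k`: a `ℤ`-graded algebra `A` with a derivation `d`
of degree `1` and a curvature element `w ∈ A²` such that `d² = [w, -]` and `d w = 0`. -/
structure CurvedAlgebra (k : Type u) [Field k] : Type (u + 1) where
  carrier : Type u
  [ring : Ring carrier]
  [algebra : Algebra k carrier]
  deg : ℤ → Submodule k carrier
  [graded : GradedAlgebra deg]
  d : carrier →ₗ[k] carrier
  d_mem : ∀ {i : ℤ} {a : carrier}, a ∈ deg i → d a ∈ deg (i + 1)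
  leibniz : ∀ {i : ℤ} {a : carrier} (b : carrier), a ∈ deg i →
    d (a * b) = d a * b + i.negOnePow • (a * d b)
  curv : carrier
  curv_mem : curv ∈ deg 2
  d_d : ∀ a : carrier, d (d a) = curv * a - a * curv
  d_curv : d curv = 0

namespace CurvedAlgebra

variable {k : Type u} [Field k]

instance : CoeSort (CurvedAlgebra k) (Type u) := ⟨CurvedAlgebra.carrier⟩

attribute [instance] CurvedAlgebra.ring CurvedAlgebra.algebra CurvedAlgebra.graded

/-- A dg algebra is a curved algebra with curvature zero. -/
def IsDG (A : CurvedAlgebra k) : Prop := A.curv = 0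

/-- Vanishing of the cohomology of `(A, d)` in every degree. -/
def IsAcyclic (A : CurvedAlgebra k) : Prop :=
  ∀ (i : ℤ) (a : A), a ∈ A.deg i → A.d a = 0 → ∃ b ∈ A.deg (i - 1), A.d b = a

/-- The parity involution `a ↦ (-1)^|a| a`. -/
def parity (A : CurvedAlgebra k) : A →ₗ[k] A :=
  (DirectSum.toModule k ℤ A fun i => i.negOnePow • (A.deg i).subtype) ∘ₗ
    (DirectSum.decomposeLinearEquiv A.deg).toLinearMap

theorem parity_of_mem (A : CurvedAlgebra k) {i : ℤ} {a : A} (ha : a ∈ A.deg i) :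
    A.parity a = i.negOnePow • a := by
  lift a to A.deg i using ha
  simp [parity]

/-- The graded commutator `[x, -] : a ↦ x a - (-1)^|a| a x` with an element `x` of degree `1`. -/
def oddCommutator (A : CurvedAlgebra k) (x : A) : A →ₗ[k] A :=
  LinearMap.mulLeft k x - LinearMap.mulRight k x ∘ₗ A.parity

theorem oddCommutator_of_mem (A : CurvedAlgebra k) (x : A) {i : ℤ} {a : A} (ha : a ∈ A.deg i) :
    A.oddCommutator x a = x * a - i.negOnePow • (a * x) := by
  simp [oddCommutator, A.parity_of_mem ha]

/-- Induction on sums of homogeneous elements. -/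
theorem hom_induction (A : CurvedAlgebra k) {P : A → Prop} (h0 : P 0)
    (hom : ∀ (i : ℤ) (a : A), a ∈ A.deg i → P a) (add : ∀ a b, P a → P b → P (a + b)) (a : A) :
    P a :=
  DirectSum.Decomposition.inductionOn A.deg h0 (fun m => hom _ m m.2) add a

/-- The twist `A^x = (A, d + [x, -], w + d x + x²)` of a curved algebra by `x ∈ A¹`. -/
def twist (A : CurvedAlgebra k) (x : A) (hx : x ∈ A.deg 1) : CurvedAlgebra k where
  carrier := A
  deg := A.deg
  d := A.d + A.oddCommutator x
  d_mem := by
    intro i a ha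
    rw [LinearMap.add_apply, A.oddCommutator_of_mem x ha]
    refine add_mem (A.d_mem ha) (sub_mem ?_ ?_)
    · rw [add_comm]; exact SetLike.mul_mem_graded hx ha
    · exact (A.deg (i + 1)).smul_of_tower_mem i.negOnePow (SetLike.mul_mem_graded ha hx)
  leibniz := by
    intro i a b ha
    induction b using A.hom_induction with
    | h0 => simp
    | add b c hb hc => rw [mul_add, map_add, hb, hc, map_add, mul_add, mul_add, smul_add]; abel
    | hom j b hb =>
      simp only [LinearMap.add_apply]
      rw [A.leibniz b ha, A.oddCommutator_of_mem x ha, A.oddCommutator_of_mem x hb,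
        A.oddCommutator_of_mem x (SetLike.mul_mem_graded ha hb), Int.negOnePow_add]
      simp only [mul_add, add_mul, mul_sub, sub_mul, smul_sub, smul_add, mul_smul_comm,
        smul_mul_assoc, mul_smul, mul_assoc]
      abel
  curv := A.curv + A.d x + x * x
  curv_mem := add_mem (add_mem A.curv_mem (A.d_mem hx)) (SetLike.mul_mem_graded hx hx)
  d_d := by
    intro a
    induction a using A.hom_induction with
    | h0 => simp
    | add a b ha hb => rw [map_add, map_add, ha, hb]; simp only [mul_add, add_mul]; abel
    | hom i a ha =>
      have h1 : A.d x * a ∈ A.deg (i + 1 + 1) := by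
        have := SetLike.mul_mem_graded (A.d_mem hx) ha
        rwa [show (1 + 1 + i : ℤ) = i + 1 + 1 by ring] at this
      have hxa : x * a ∈ A.deg (i + 1) := by
        rw [add_comm]; exact SetLike.mul_mem_graded hx ha
      have hax : a * x ∈ A.deg (i + 1) := SetLike.mul_mem_graded ha hx
      simp only [LinearMap.add_apply]
      rw [A.oddCommutator_of_mem x ha]
      simp only [map_add, map_sub, LinearMap.map_smul_of_tower]
      rw [A.oddCommutator_of_mem x (A.d_mem ha), A.oddCommutator_of_mem x hxa,
        A.oddCommutator_of_mem x hax, A.leibniz a hx, A.leibniz x ha, A.d_d]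
      rcases Int.even_or_odd i with h | h <;>
        simp [Int.negOnePow_even, Int.negOnePow_odd, h, mul_add, add_mul, mul_assoc] <;> abel
  d_curv := by
    have h2 : A.d x ∈ A.deg 2 := A.d_mem hx
    have h3 : x * x ∈ A.deg 2 := SetLike.mul_mem_graded hx hx
    simp only [LinearMap.add_apply, map_add]
    rw [A.oddCommutator_of_mem x A.curv_mem, A.oddCommutator_of_mem x h2,
      A.oddCommutator_of_mem x h3, A.leibniz x hx, A.d_d, A.d_curv]
    have e2 : (2 : ℤ).negOnePow = 1 := Int.negOnePow_even 2 (by decide)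
    have e1 : (1 : ℤ).negOnePow = -1 := Int.negOnePow_odd 1 (by decide)
    simp [e1, e2, mul_assoc]
    abel


open TensorProduct in
/-- The grading of `A ⊗ B` by total degree. -/
def tensorDeg (A B : CurvedAlgebra k) (n : ℤ) : Submodule k (A.deg ᵍ⊗[k] B.deg) :=
  Submodule.span k {z | ∃ (i j : ℤ) (a : A) (b : B),
    a ∈ A.deg i ∧ b ∈ B.deg j ∧ i + j = n ∧ z = a ᵍ⊗ₜ[k] b}

section Tensor

open TensorProduct GradedTensorProduct

variable (A B : CurvedAlgebra k)

theorem tmul_mem {i j n : ℤ} {a : A} {b : B} (ha : a ∈ A.deg i) (hb : b ∈ B.deg j)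
    (h : i + j = n) : (a ᵍ⊗ₜ[k] b : A.deg ᵍ⊗[k] B.deg) ∈ tensorDeg A B n :=
  Submodule.subset_span ⟨i, j, a, b, ha, hb, h, rfl⟩

theorem tmul_mul_tmul {j l : ℤ} (a c : A) (b e : B) (hb : b ∈ B.deg j) (hc : c ∈ A.deg l) :
    (a ᵍ⊗ₜ[k] b * c ᵍ⊗ₜ[k] e : A.deg ᵍ⊗[k] B.deg) =
      (j * l).negOnePow • ((a * c) ᵍ⊗ₜ[k] (b * e)) :=
  tmul_coe_mul_coe_tmul A.deg B.deg a ⟨b, hb⟩ ⟨c, hc⟩ e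

theorem tensor_smul_mul (c : k) (y z : A.deg ᵍ⊗[k] B.deg) : (c • y) * z = c • (y * z) :=
  Algebra.smul_mul_assoc c y z

theorem tensor_mul_smul (c : k) (y z : A.deg ᵍ⊗[k] B.deg) : y * (c • z) = c • (y * z) :=
  Algebra.mul_smul_comm c y z

theorem tensor_mul_units (c : ℤˣ) (y z : A.deg ᵍ⊗[k] B.deg) : y * (c • z) = c • (y * z) := by
  rcases Int.units_eq_one_or c with rfl | rfl
  · simp
  · rw [Units.neg_smul, one_smul, Units.neg_smul, one_smul]; exact mul_neg y z

theorem tmul_units (c : ℤˣ) (a : A) (b : B) :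
    (a ᵍ⊗ₜ[k] (c • b) : A.deg ᵍ⊗[k] B.deg) = c • (a ᵍ⊗ₜ[k] b) := by
  rcases Int.units_eq_one_or c with rfl | rfl
  · simp
  · rw [Units.neg_smul, one_smul, Units.neg_smul, one_smul]; exact TensorProduct.tmul_neg a b

theorem units_tmul (c : ℤˣ) (a : A) (b : B) :
    ((c • a) ᵍ⊗ₜ[k] b : A.deg ᵍ⊗[k] B.deg) = c • (a ᵍ⊗ₜ[k] b) := by
  rcases Int.units_eq_one_or c with rfl | rfl
  · simp
  · rw [Units.neg_smul, one_smul, Units.neg_smul, one_smul]; exact TensorProduct.neg_tmul a b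

theorem tmul_add' (a : A) (b c : B) :
    (a ᵍ⊗ₜ[k] (b + c) : A.deg ᵍ⊗[k] B.deg) = a ᵍ⊗ₜ[k] b + a ᵍ⊗ₜ[k] c := tmul_add _ _ _

theorem add_tmul' (a b : A) (c : B) :
    ((a + b) ᵍ⊗ₜ[k] c : A.deg ᵍ⊗[k] B.deg) = a ᵍ⊗ₜ[k] c + b ᵍ⊗ₜ[k] c := add_tmul _ _ _

theorem tmul_sub' (a : A) (b c : B) :
    (a ᵍ⊗ₜ[k] (b - c) : A.deg ᵍ⊗[k] B.deg) = a ᵍ⊗ₜ[k] b - a ᵍ⊗ₜ[k] c := tmul_sub _ _ _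

theorem sub_tmul' (a b : A) (c : B) :
    ((a - b) ᵍ⊗ₜ[k] c : A.deg ᵍ⊗[k] B.deg) = a ᵍ⊗ₜ[k] c - b ᵍ⊗ₜ[k] c := sub_tmul _ _ _

theorem tensor_hom_induction {P : A.deg ᵍ⊗[k] B.deg → Prop} (h0 : P 0)
    (hom : ∀ (i j : ℤ) (a : A) (b : B), a ∈ A.deg i → b ∈ B.deg j → P (a ᵍ⊗ₜ[k] b))
    (add : ∀ y z, P y → P z → P (y + z)) (z : A.deg ᵍ⊗[k] B.deg) : P z := by
  change A ⊗[k] B at z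
  induction z using TensorProduct.induction_on with
  | zero => exact h0
  | add y z hy hz => exact add _ _ hy hz
  | tmul a b =>
    induction a using A.hom_induction with
    | h0 => rw [zero_tmul]; exact h0
    | add a a' h h' => rw [add_tmul]; exact add _ _ h h'
    | hom i a ha =>
      induction b using B.hom_induction with
      | h0 => rw [tmul_zero]; exact h0
      | add a a' h h' => rw [tmul_add]; exact add _ _ h h'
      | hom j b hb => exact hom i j a b ha hb

/-- The decomposition of `A ⊗ B` into its components of given total degree. -/
def tensorDecompose : (A.deg ᵍ⊗[k] B.deg) →ₗ[k] ⨁ n, tensorDeg A B n :=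
  TensorProduct.lift ((DirectSum.toModule k ℤ _ fun i =>
    LinearMap.flip (DirectSum.toModule k ℤ _ fun j => LinearMap.flip
      ((LinearMap.mk₂ k (fun (a : A.deg i) (b : B.deg j) =>
        (⟨(a : A) ᵍ⊗ₜ[k] (b : B), tmul_mem A B a.2 b.2 rfl⟩ : tensorDeg A B (i + j)))
        (fun _ _ _ => Subtype.ext (add_tmul _ _ _))
        (fun _ _ _ => Subtype.ext (smul_tmul' _ _ _).symm)
        (fun _ _ _ => Subtype.ext (tmul_add _ _ _))
        (fun _ _ _ => Subtype.ext (tmul_smul _ _ _))).compr₂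
          (DirectSum.lof k ℤ (fun n => tensorDeg A B n) (i + j))))).compl₁₂
    (DirectSum.decomposeLinearEquiv A.deg).toLinearMap
    (DirectSum.decomposeLinearEquiv B.deg).toLinearMap) ∘ₗ (of k A.deg B.deg).symm.toLinearMap

theorem tensorDecompose_tmul {i j : ℤ} {a : A} {b : B} (ha : a ∈ A.deg i) (hb : b ∈ B.deg j) :
    tensorDecompose A B (a ᵍ⊗ₜ[k] b) =
      DirectSum.lof k ℤ (fun n => tensorDeg A B n) (i + j) ⟨_, tmul_mem A B ha hb rfl⟩ := by
  lift a to A.deg i using ha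
  lift b to B.deg j using hb
  simp [tensorDecompose]

theorem tensorDecompose_of_mem {n : ℤ} {z : A.deg ᵍ⊗[k] B.deg} (hz : z ∈ tensorDeg A B n) :
    tensorDecompose A B z = DirectSum.lof k ℤ (fun n => tensorDeg A B n) n ⟨z, hz⟩ := by
  induction hz using Submodule.span_induction with
  | mem z h =>
    obtain ⟨i, j, a, b, ha, hb, rfl, rfl⟩ := h
    exact tensorDecompose_tmul A B ha hb
  | zero => rw [map_zero]; exact (map_zero _).symm
  | add y z hy hz h1 h2 => rw [map_add, h1, h2, ← map_add]; rfl
  | smul c z hz h => rw [map_smul, h, ← map_smul]; rfl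

instance tensorGraded : GradedAlgebra (tensorDeg A B) where
  one_mem := tmul_mem A B (SetLike.GradedOne.one_mem) (SetLike.GradedOne.one_mem) (zero_add 0)
  mul_mem := by
    intro m n y z hy hz
    induction hy using Submodule.span_induction with
    | zero => rw [zero_mul]; exact zero_mem _
    | add y y' _ _ h1 h2 => rw [add_mul]; exact add_mem h1 h2
    | smul c y _ h => rw [tensor_smul_mul]; exact Submodule.smul_mem _ c h
    | mem y hy =>
      obtain ⟨i, j, a, b, ha, hb, rfl, rfl⟩ := hy
      induction hz using Submodule.span_induction with
      | zero => rw [mul_zero]; exact zero_mem _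
      | add y y' _ _ h1 h2 => rw [mul_add]; exact add_mem h1 h2
      | smul c y _ h => rw [tensor_mul_smul]; exact Submodule.smul_mem _ c h
      | mem z hz =>
        obtain ⟨i', j', a', b', ha', hb', rfl, rfl⟩ := hz
        rw [tmul_mul_tmul A B _ _ _ _ hb ha']
        exact (tensorDeg A B _).smul_of_tower_mem _
          (tmul_mem A B (SetLike.mul_mem_graded ha ha') (SetLike.mul_mem_graded hb hb') (by ring))
  toDecomposition := DirectSum.Decomposition.ofLinearMap _ (tensorDecompose A B)
    (by
      refine LinearMap.ext fun z => ?_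
      induction z using tensor_hom_induction with
      | h0 => simp only [map_zero]
      | add y z hy hz => rw [map_add, hy, hz, map_add]
      | hom i j a b ha hb =>
        rw [LinearMap.comp_apply, tensorDecompose_tmul A B ha hb, DirectSum.coeLinearMap_lof]; rfl)
    (by
      apply DirectSum.linearMap_ext
      intro n
      ext1 z
      rw [LinearMap.comp_apply, LinearMap.comp_apply, DirectSum.coeLinearMap_lof,
        tensorDecompose_of_mem A B z.2]; rfl)

/-- The differential `a ⊗ b ↦ d a ⊗ b + (-1)^|a| a ⊗ d b`. -/
def tensorD : (A.deg ᵍ⊗[k] B.deg) →ₗ[k] (A.deg ᵍ⊗[k] B.deg) :=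
  (of k A.deg B.deg).toLinearMap ∘ₗ
    (TensorProduct.map A.d LinearMap.id + TensorProduct.map A.parity B.d) ∘ₗ
    (of k A.deg B.deg).symm.toLinearMap

theorem tensorD_tmul {i : ℤ} {a : A} (b : B) (ha : a ∈ A.deg i) :
    tensorD A B (a ᵍ⊗ₜ[k] b) = A.d a ᵍ⊗ₜ[k] b + i.negOnePow • (a ᵍ⊗ₜ[k] B.d b) := by
  have : A.parity a ⊗ₜ[k] B.d b = i.negOnePow • (a ⊗ₜ[k] B.d b) := by
    rw [A.parity_of_mem ha]; rfl
  simp [tensorD, this]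

/-- The tensor product `(A ⊗ B, d ⊗ 1 + 1 ⊗ d, w ⊗ 1 + 1 ⊗ w)` of curved algebras, with the
Koszul sign rule `(a ⊗ b) (c ⊗ e) = (-1)^(|b| |c|) a c ⊗ b e`. -/
def tensor : CurvedAlgebra k where
  carrier := A.deg ᵍ⊗[k] B.deg
  deg := tensorDeg A B
  d := tensorD A B
  d_mem := by
    intro n z hz
    induction hz using Submodule.span_induction with
    | zero => rw [map_zero]; exact zero_mem _
    | add y y' _ _ h1 h2 => rw [map_add]; exact add_mem h1 h2
    | smul c y _ h => rw [map_smul]; exact Submodule.smul_mem _ c h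
    | mem z hz =>
      obtain ⟨i, j, a, b, ha, hb, rfl, rfl⟩ := hz
      rw [tensorD_tmul A B b ha]
      exact add_mem (tmul_mem A B (A.d_mem ha) hb (by ring))
        ((tensorDeg A B _).smul_of_tower_mem _ (tmul_mem A B ha (B.d_mem hb) (by ring)))
  leibniz := by
    intro n y z hy
    induction hy using Submodule.span_induction with
    | zero => simp
    | add y y' _ _ h1 h2 => rw [add_mul, map_add, h1, h2, map_add]; simp only [add_mul, smul_add]; abel
    | smul c y _ h =>
      rw [tensor_smul_mul, map_smul, h, map_smul, tensor_smul_mul, tensor_smul_mul, smul_add,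
        smul_comm c]
    | mem y hy =>
      obtain ⟨i, j, a, b, ha, hb, rfl, rfl⟩ := hy
      induction z using tensor_hom_induction with
      | h0 => simp
      | add y z hy hz => rw [mul_add, map_add, hy, hz, map_add]; simp only [mul_add, smul_add]; abel
      | hom i' j' a' b' ha' hb' =>
        rw [tmul_mul_tmul A B _ _ _ _ hb ha', LinearMap.map_smul_of_tower,
          tensorD_tmul A B _ (SetLike.mul_mem_graded ha ha'), tensorD_tmul A B _ ha,
          tensorD_tmul A B _ ha', A.leibniz _ ha, B.leibniz _ hb]
        simp only [add_mul, mul_add, smul_mul_assoc, tensor_mul_units]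
        rw [tmul_mul_tmul A B _ _ _ _ hb ha', tmul_mul_tmul A B _ _ _ _ (B.d_mem hb) ha',
          tmul_mul_tmul A B _ _ _ _ hb (A.d_mem ha'), tmul_mul_tmul A B _ _ _ _ hb ha']
        simp only [tmul_add', add_tmul', tmul_units, units_tmul]
        rcases Int.even_or_odd i with h1 | h1 <;> rcases Int.even_or_odd j with h2 | h2 <;>
          rcases Int.even_or_odd i' with h3 | h3 <;>
          simp [Int.negOnePow_add, Int.negOnePow_even, Int.negOnePow_odd, h1, h2, h3, mul_add,
            add_mul] <;> abel
  curv := A.curv ᵍ⊗ₜ[k] 1 + 1 ᵍ⊗ₜ[k] B.curv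
  curv_mem := add_mem (tmul_mem A B A.curv_mem SetLike.GradedOne.one_mem (by norm_num))
    (tmul_mem A B SetLike.GradedOne.one_mem B.curv_mem (by norm_num))
  d_d := by
    intro z
    induction z using tensor_hom_induction with
    | h0 => simp
    | add a b ha hb => rw [map_add, map_add, ha, hb]; simp only [mul_add, add_mul]; abel
    | hom i j a b ha hb =>
      rw [tensorD_tmul A B b ha, map_add, LinearMap.map_smul_of_tower,
        tensorD_tmul A B b (A.d_mem ha), tensorD_tmul A B _ ha, A.d_d, B.d_d, add_mul, mul_add,
        tmul_mul_tmul A B _ _ _ _ SetLike.GradedOne.one_mem ha,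
        tmul_mul_tmul A B _ _ _ _ B.curv_mem ha,
        tmul_mul_tmul A B _ _ _ _ hb A.curv_mem,
        tmul_mul_tmul A B _ _ _ _ hb SetLike.GradedOne.one_mem]
      simp only [tmul_sub', sub_tmul']
      rcases Int.even_or_odd i with h1 | h1 <;>
        simp [Int.negOnePow_even, Int.negOnePow_odd, h1] <;> abel
  d_curv := by
    have hA : A.d 1 = 0 := by simpa using A.leibniz 1 SetLike.GradedOne.one_mem
    have hB : B.d 1 = 0 := by simpa using B.leibniz 1 SetLike.GradedOne.one_mem
    rw [map_add, tensorD_tmul A B _ A.curv_mem, tensorD_tmul A B _ SetLike.GradedOne.one_mem,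
      A.d_curv, B.d_curv, hA, hB]
    simp only [GradedTensorProduct.tmul, tmul_zero, zero_tmul, map_zero, smul_zero, add_zero]

variable {A B} in
/-- The element `a ⊗ b` of the tensor product of curved algebras. -/
def tmul (a : A) (b : B) : A.tensor B := (a ᵍ⊗ₜ[k] b : A.deg ᵍ⊗[k] B.deg)

end Tensor

section End

variable {ι : Type} [DecidableEq ι] (p : ι → ℤ)

/-- The degree `n` endomorphisms of the graded vector space `V = ⨁ i, k e_i`, `|e_i| = p i`, as
matrices: the elementary matrix `e_j ↦ e_i` has degree `p i - p j`. -/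
def endDeg (k : Type u) [Field k] (n : ℤ) : Submodule k (Matrix ι ι k) where
  carrier := {M | ∀ i j, M i j ≠ 0 → p i - p j = n}
  zero_mem' := by intro i j h; exact absurd rfl h
  add_mem' := by
    intro M N hM hN i j h
    by_cases h0 : M i j = 0
    · exact hN i j (by simpa [h0] using h)
    · exact hM i j h0
  smul_mem' := by
    intro c M hM i j h
    exact hM i j (by intro h0; simp [h0] at h)

theorem single_mem_endDeg (i j : ι) (c : k) {n : ℤ} (h : p i - p j = n) :
    Matrix.single i j c ∈ endDeg p k n := by
  intro a b hab
  by_cases hh : i = a ∧ j = b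
  · rw [← hh.1, ← hh.2]; exact h
  · exact absurd (Matrix.single_apply_of_ne _ _ _ _ _ hh) hab

variable [Fintype ι]

instance endGraded : GradedAlgebra (endDeg p k) where
  one_mem := by
    intro i j h
    have : i = j := by
      by_contra hij
      exact h (Matrix.one_apply_ne hij)
    rw [this, sub_self]
  mul_mem := by
    intro m n M N hM hN i j h
    rw [Matrix.mul_apply] at h
    obtain ⟨l, _, hl⟩ := Finset.exists_ne_zero_of_sum_ne_zero h
    rw [← hM i l (left_ne_zero_of_mul hl), ← hN l j (right_ne_zero_of_mul hl)]
    ring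
  toDecomposition := DirectSum.Decomposition.ofLinearMap _
    (∑ i, ∑ j, DirectSum.lof k ℤ (fun n => endDeg p k n) (p i - p j) ∘ₗ
      LinearMap.codRestrict (endDeg p k (p i - p j))
        (Matrix.singleLinearMap k i j ∘ₗ Matrix.entryLinearMap k k i j)
        (fun M => single_mem_endDeg p i j _ rfl))
    (by
      refine LinearMap.ext fun M => ?_
      conv_rhs => rw [LinearMap.id_apply, Matrix.matrix_eq_sum_single M]
      simp only [LinearMap.comp_apply, LinearMap.sum_apply, map_sum, DirectSum.coeLinearMap_lof]
      rfl)
    (by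
      apply DirectSum.linearMap_ext
      intro n
      refine LinearMap.ext fun M => ?_
      have key : ∀ i j, DirectSum.lof k ℤ (fun n => endDeg p k n) (p i - p j)
          ⟨Matrix.single i j (M.1 i j), single_mem_endDeg p i j _ rfl⟩ =
          DirectSum.lof k ℤ (fun n => endDeg p k n) n
            ⟨Matrix.single i j (M.1 i j), by
              by_cases h : M.1 i j = 0
              · rw [h, Matrix.single_zero]; exact zero_mem _
              · exact single_mem_endDeg p i j _ (M.2 i j h)⟩ := by
        intro i j
        by_cases h : M.1 i j = 0
        · have h0 : ∀ (m : ℤ) (hm : Matrix.single i j (M.1 i j) ∈ endDeg p k m),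
              (⟨_, hm⟩ : endDeg p k m) = 0 := fun m hm => Subtype.ext (by simp [h])
          rw [h0, h0, map_zero, map_zero]
        · have hn := M.2 i j h
          subst hn
          rfl
      simp only [LinearMap.comp_apply, LinearMap.sum_apply, DirectSum.coeLinearMap_lof,
        LinearMap.id_apply]
      refine (Finset.sum_congr rfl fun i _ => Finset.sum_congr rfl fun j _ => key i j).trans ?_
      simp only [← map_sum]
      congr 1
      apply Subtype.ext
      simp only [AddSubmonoidClass.coe_finsetSum]
      exact (Matrix.matrix_eq_sum_single M.1).symm)

/-- The graded algebra `End(V)`, with zero differential and zero curvature, for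
`V = ⨁ i, k e_i` with `|e_i| = p i`. -/
def endAlgebra (k : Type u) [Field k] : CurvedAlgebra k where
  carrier := Matrix ι ι k
  deg := endDeg p k
  d := 0
  d_mem := fun _ => zero_mem _
  leibniz := by simp
  curv := 0
  curv_mem := zero_mem _
  d_d := by simp
  d_curv := rfl

end End

/-- The degrees `0`, `-1` of the basis vectors of `k ⊕ k[1]`. -/
def shiftDegrees : Fin 2 → ℤ := ![0, -1]

/-- The curved algebra `A ⊗ End(k ⊕ k[1])`, where `End(k ⊕ k[1])` consists of `2 × 2` matrices. -/
def tensorEnd (A : CurvedAlgebra k) : CurvedAlgebra k :=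
  A.tensor (endAlgebra shiftDegrees k)

/-- The element `x_w` of `A ⊗ End(k ⊕ k[1])`, i.e. the matrix with rows `(0, -1)` and `(w, 0)`,
where `w` is the curvature of `A`. -/
def uncurvingElement (A : CurvedAlgebra k) : A.tensorEnd :=
  tmul (B := endAlgebra shiftDegrees k) A.curv !![0, 0; 1, 0] -
    tmul (B := endAlgebra shiftDegrees k) 1 !![0, 1; 0, 0]

theorem uncurvingElement_mem (A : CurvedAlgebra k) :
    A.uncurvingElement ∈ A.tensorEnd.deg 1 := by
  have h1 : (!![0, 0; 1, 0] : Matrix (Fin 2) (Fin 2) k) ∈ endDeg shiftDegrees k (-1) := by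
    intro i j h
    fin_cases i <;> fin_cases j <;> simp [shiftDegrees] at h ⊢
  have h2 : (!![0, 1; 0, 0] : Matrix (Fin 2) (Fin 2) k) ∈ endDeg shiftDegrees k 1 := by
    intro i j h
    fin_cases i <;> fin_cases j <;> simp [shiftDegrees] at h ⊢
  refine sub_mem (tmul_mem A (endAlgebra shiftDegrees k) A.curv_mem h1 (n := 1) (by norm_num))
    (tmul_mem A (endAlgebra shiftDegrees k) SetLike.GradedOne.one_mem h2 (n := 1)
      (by norm_num))

/-- The twisted algebra `A' = (A ⊗ End(k ⊕ k[1]))^{x_w}`. -/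
def uncurving (A : CurvedAlgebra k) : CurvedAlgebra k :=
  A.tensorEnd.twist A.uncurvingElement A.uncurvingElement_mem

end CurvedAlgebra

/-- A dg category over `k` with class of objects `C`: complexes `Hom X Y` of `k`-modules,
identities, and associative unital bilinear compositions satisfying the graded Leibniz rule.
`comp h g f` is the composite `g ∘ f`. -/
class DGCategory (k : Type*) [Field k] (C : Type*) where
  Hom : C → C → ℤ → Type u
  [addCommGroup : ∀ X Y n, AddCommGroup (Hom X Y n)]
  [module : ∀ X Y n, Module k (Hom X Y n)]
  d : ∀ {X Y : C} (i j : ℤ), i + 1 = j → (Hom X Y i →ₗ[k] Hom X Y j)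
  id : ∀ X : C, Hom X X 0
  comp : ∀ {X Y Z : C} {q p r : ℤ}, q + p = r → (Hom Y Z q →ₗ[k] Hom X Y p →ₗ[k] Hom X Z r)
  d_d : ∀ {X Y : C} (i j l : ℤ) (hij : i + 1 = j) (hjl : j + 1 = l) (f : Hom X Y i),
    d j l hjl (d i j hij f) = 0
  leibniz : ∀ {X Y Z : C} {q p r : ℤ} (h : q + p = r) (g : Hom Y Z q) (f : Hom X Y p),
    d r (r + 1) rfl (comp h g f) =
      comp (show q + 1 + p = r + 1 by omega) (d q (q + 1) rfl g) f +
        q.negOnePow • comp (show q + (p + 1) = r + 1 by omega) g (d p (p + 1) rfl f)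
  id_comp : ∀ {X Y : C} {n : ℤ} (f : Hom X Y n), comp (zero_add n) (id Y) f = f
  comp_id : ∀ {X Y : C} {n : ℤ} (f : Hom X Y n), comp (add_zero n) f (id X) = f
  assoc : ∀ {W X Y Z : C} {r q p qp rq s : ℤ} (h₁ : q + p = qp) (h₂ : r + qp = s)
    (h₃ : r + q = rq) (h₄ : rq + p = s) (h : Hom Y Z r) (g : Hom X Y q) (f : Hom W X p),
    comp h₂ h (comp h₁ g f) = comp h₄ (comp h₃ h g) f

namespace DGCategory

attribute [reducible, instance] DGCategory.addCommGroup DGCategory.module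

variable (k : Type u) [Field k]

/-- The full dg subcategory on the objects satisfying `P`. -/
instance fullSubcategory {C : Type*} [DGCategory.{u} k C] (P : C → Prop) :
    DGCategory.{u} k {X : C // P X} where
  Hom X Y := Hom k X.1 Y.1
  d := d
  id X := DGCategory.id X.1
  comp := comp
  d_d := d_d
  leibniz := leibniz
  id_comp := id_comp
  comp_id := comp_id
  assoc := assoc

variable {C : Type*} [DGCategory.{u} k C]

/-- `X` and `Y` are homotopy equivalent, i.e. isomorphic in `H⁰`: there are closed morphisms
`f : X → Y` and `g : Y → X` of degree `0` such that `g f` and `f g` differ from the identities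
by coboundaries. -/
def HomotopyEquivalent (X Y : C) : Prop :=
  ∃ (f : Hom k X Y 0) (g : Hom k Y X 0), d 0 1 rfl f = 0 ∧ d 0 1 rfl g = 0 ∧
    (∃ s : Hom k X X (-1), d (-1) 0 rfl s = comp (add_zero 0) g f - DGCategory.id X) ∧
    (∃ t : Hom k Y Y (-1), d (-1) 0 rfl t = comp (add_zero 0) f g - DGCategory.id Y)

/-- `X` is a direct summand of `Y`: there are closed morphisms `s : X → Y` and `r : Y → X` of
degree `0` with `r s = 1`. -/
def IsDirectSummand (X Y : C) : Prop :=
  ∃ (s : Hom k X Y 0) (r : Hom k Y X 0), d 0 1 rfl s = 0 ∧ d 0 1 rfl r = 0 ∧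
    comp (add_zero 0) r s = DGCategory.id X

/-- A degree-preserving family of maps `φ` between the complexes `Hom X Y` and `Hom X' Y'`
is a quasi-isomorphism: it commutes with the differentials and the induced map on cohomology is
injective and surjective in every degree. -/
def IsQuasiIso {C' : Type*} [DGCategory.{u} k C'] {X Y : C} {X' Y' : C'}
    (φ : ∀ n, Hom k X Y n →ₗ[k] Hom k X' Y' n) : Prop :=
  (∀ i j (h : i + 1 = j) (f : Hom k X Y i), φ j (d i j h f) = d i j h (φ i f)) ∧
  (∀ i j l (hij : i + 1 = j) (hjl : j + 1 = l) (f : Hom k X Y j), d j l hjl f = 0 →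
    (∃ g' : Hom k X' Y' i, d i j hij g' = φ j f) → ∃ g : Hom k X Y i, d i j hij g = f) ∧
  (∀ i j l (hij : i + 1 = j) (hjl : j + 1 = l) (f' : Hom k X' Y' j), d j l hjl f' = 0 →
    ∃ f : Hom k X Y j, d j l hjl f = 0 ∧ ∃ g' : Hom k X' Y' i, d i j hij g' = f' - φ j f)

end DGCategory

/-- A dg functor between dg categories. -/
structure DGFunctor (k : Type u) [Field k] (C D : Type*) [DGCategory.{u} k C]
    [DGCategory.{u} k D] where
  obj : C → D
  map : ∀ {X Y : C} (n : ℤ), DGCategory.Hom k X Y n →ₗ[k] DGCategory.Hom k (obj X) (obj Y) n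
  map_d : ∀ {X Y : C} (i j : ℤ) (h : i + 1 = j) (f : DGCategory.Hom k X Y i),
    map j (DGCategory.d i j h f) = DGCategory.d i j h (map i f)
  map_id : ∀ X : C, map 0 (DGCategory.id X) = DGCategory.id (k := k) (obj X)
  map_comp : ∀ {X Y Z : C} {q p r : ℤ} (h : q + p = r) (g : DGCategory.Hom k Y Z q)
    (f : DGCategory.Hom k X Y p),
    map r (DGCategory.comp h g f) = DGCategory.comp h (map q g) (map p f)

/-- A dg functor is a quasi-equivalence if it induces quasi-isomorphisms on all morphism complexes
and is essentially surjective on `H⁰`. -/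
def DGFunctor.IsQuasiEquivalence {k : Type u} [Field k] {C D : Type*} [DGCategory.{u} k C]
    [DGCategory.{u} k D] (F : DGFunctor k C D) : Prop :=
  (∀ X Y : C, DGCategory.IsQuasiIso k (fun n => F.map (X := X) (Y := Y) n)) ∧
    ∀ Z : D, ∃ X : C, DGCategory.HomotopyEquivalent k (F.obj X) Z

/-- A (right) curved module over a curved algebra `(A, d, w)`: a graded right `A`-module with a
derivation `d` of degree `1` such that `d² m = - m w`. With `d² = [w, -]` on `A`, this is the sign
that the Leibniz rule forces on right modules. The right action is `m a = MulOpposite.op a • m`. -/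
structure CurvedModule {k : Type u} [Field k] (A : CurvedAlgebra k) : Type (u + 1) where
  carrier : Type u
  [addCommGroup : AddCommGroup carrier]
  [module : Module k carrier]
  [rightModule : Module (A.carrier)ᵐᵒᵖ carrier]
  [isScalarTower : IsScalarTower k (A.carrier)ᵐᵒᵖ carrier]
  deg : ℤ → Submodule k carrier
  [decomposition : DirectSum.Decomposition deg]
  smul_mem : ∀ {i j : ℤ} {m : carrier} {a : A}, m ∈ deg i → a ∈ A.deg j →
    MulOpposite.op a • m ∈ deg (i + j)
  d : carrier →ₗ[k] carrier
  d_mem : ∀ {i : ℤ} {m : carrier}, m ∈ deg i → d m ∈ deg (i + 1)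
  leibniz : ∀ {i : ℤ} {m : carrier} (a : A), m ∈ deg i →
    d (MulOpposite.op a • m) =
      MulOpposite.op a • d m + i.negOnePow • (MulOpposite.op (A.d a) • m)
  d_d : ∀ m : carrier, d (d m) = -(MulOpposite.op A.curv • m)

namespace CurvedModule

variable {k : Type u} [Field k] {A : CurvedAlgebra k}

instance : CoeSort (CurvedModule A) (Type u) := ⟨CurvedModule.carrier⟩

attribute [instance] CurvedModule.addCommGroup CurvedModule.module CurvedModule.rightModule
  CurvedModule.isScalarTower CurvedModule.decomposition

/-- The `A`-linear maps `M → N` of degree `n`. -/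
def homDeg (M N : CurvedModule A) (n : ℤ) : Submodule k (M →ₗ[(A.carrier)ᵐᵒᵖ] N) where
  carrier := {f | ∀ (i : ℤ) (m : M), m ∈ M.deg i → f m ∈ N.deg (i + n)}
  zero_mem' := fun _ _ _ => zero_mem _
  add_mem' := fun hf hg i m hm => add_mem (hf i m hm) (hg i m hm)
  smul_mem' := fun c _ hf i m hm => Submodule.smul_mem _ c (hf i m hm)

/-- The differential `f ↦ d f - (-1)^n f d` on the `A`-linear maps of degree `n`. -/
def homD (M N : CurvedModule A) (n l : ℤ) (h : n + 1 = l) : homDeg M N n →ₗ[k] homDeg M N l where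
  toFun f :=
    ⟨{ toFun := fun m => N.d (f.1 m) - n.negOnePow • f.1 (M.d m)
       map_add' := fun m m' => by simp only [map_add, smul_add]; abel
       map_smul' := fun b m => by
        induction b using MulOpposite.rec' with | _ a =>
        simp only [RingHom.id_apply]
        induction m using DirectSum.Decomposition.inductionOn M.deg with
        | zero => simp
        | add m m' hm hm' =>
          simp only [map_add, smul_add] at hm hm' ⊢
          rw [add_sub_add_comm, hm, hm', ← smul_add, add_sub_add_comm]
        | @homogeneous i m =>
          rw [map_smul, N.leibniz a (f.2 i m m.2), M.leibniz a m.2]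
          rw [map_add, LinearMap.map_smul_of_tower f.1 i.negOnePow, map_smul, map_smul, Int.negOnePow_add]
          simp only [smul_add, smul_sub, mul_smul]
          rw [smul_comm n.negOnePow i.negOnePow, smul_comm n.negOnePow (MulOpposite.op a)]
          abel },
      fun i m hm => by
        subst h
        refine sub_mem ?_ ((N.deg _).smul_of_tower_mem _ ?_)
        · have := N.d_mem (f.2 i m hm)
          rwa [add_assoc] at this
        · have := f.2 _ _ (M.d_mem hm)
          rwa [add_assoc, add_comm 1 n] at this⟩
  map_add' f g := by
    ext m
    simp only [Submodule.coe_add, LinearMap.add_apply, LinearMap.coe_mk, AddHom.coe_mk, map_add,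
      smul_add]
    abel
  map_smul' c f := by
    ext m
    simp only [Submodule.coe_smul, LinearMap.smul_apply, LinearMap.coe_mk, AddHom.coe_mk, map_smul,
      RingHom.id_apply, smul_sub, smul_comm c]

/-- Composition of `A`-linear maps of degrees `q` and `p`. -/
def homComp (M N P : CurvedModule A) (q p r : ℤ) (h : q + p = r) :
    homDeg N P q →ₗ[k] homDeg M N p →ₗ[k] homDeg M P r :=
  LinearMap.mk₂ k
    (fun g f => ⟨g.1 ∘ₗ f.1, fun i m hm => by
      have := g.2 _ _ (f.2 i m hm)
      rwa [add_assoc, add_comm p q, h] at this⟩)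
    (fun _ _ _ => rfl) (fun _ _ _ => rfl)
    (fun g f f' => Subtype.ext (LinearMap.comp_add _ _ _))
    (fun c g f => by
      ext m
      exact LinearMap.map_smul_of_tower g.1 c (f.1 m))

/-- The dg category of curved `A`-modules. -/
instance dgCategory : DGCategory.{u} k (CurvedModule A) where
  Hom M N n := homDeg M N n
  d := fun i j h => homD _ _ i j h
  id M := ⟨LinearMap.id, fun i m hm => by rwa [add_zero]⟩
  comp h := homComp _ _ _ _ _ _ h
  d_d := by
    rintro M N i j l rfl rfl f
    ext m
    change N.d (N.d (f.1 m) - i.negOnePow • f.1 (M.d m)) - (i + 1).negOnePow •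
      (N.d (f.1 (M.d m)) - i.negOnePow • f.1 (M.d (M.d m))) = 0
    rw [map_sub, LinearMap.map_smul_of_tower, N.d_d, M.d_d, map_neg, map_smul]
    rcases Int.even_or_odd i with h | h <;>
      simp [Int.negOnePow_even, Int.negOnePow_odd, h] <;> abel
  leibniz := by
    rintro M N P q p r rfl g f
    ext m
    change P.d (g.1 (f.1 m)) - (q + p).negOnePow • g.1 (f.1 (M.d m)) =
      (P.d (g.1 (f.1 m)) - q.negOnePow • g.1 (N.d (f.1 m))) +
        q.negOnePow • g.1 (N.d (f.1 m) - p.negOnePow • f.1 (M.d m))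
    rw [map_sub, LinearMap.map_smul_of_tower, Int.negOnePow_add, smul_sub, mul_smul]
    abel
  id_comp _ := rfl
  comp_id _ := rfl
  assoc _ _ _ _ _ _ _ := rfl

/-- A finitely generated twisted module: a curved module whose underlying graded `A`-module is
isomorphic to `V ⊗ A` for a finite-dimensional graded vector space `V`. -/
def IsFGTwisted (M : CurvedModule A) : Prop :=
  ∃ (V : Type u) (_ : AddCommGroup V) (_ : Module k V) (degV : ℤ → Submodule k V)
    (φ : TensorProduct k V A.carrier ≃ₗ[k] M),
    FiniteDimensional k V ∧ DirectSum.IsInternal degV ∧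
    (∀ (v : V) (a b : A), φ (v ⊗ₜ[k] (a * b)) = MulOpposite.op b • φ (v ⊗ₜ[k] a)) ∧
    ∀ (i j : ℤ) (v : V) (a : A), v ∈ degV i → a ∈ A.deg j → φ (v ⊗ₜ[k] a) ∈ M.deg (i + j)

/-- A morphism of curved modules, i.e. an `A`-linear map of degree `0` commuting with the
differentials. -/
def IsClosedHom {M N : CurvedModule A} (f : homDeg M N 0) : Prop :=
  ∀ m : M, N.d (f.1 m) = f.1 (M.d m)

/-- A morphism of curved modules is a weak equivalence of the second kind if it induces a
quasi-isomorphism `Hom(T, M) → Hom(T, N)` for every finitely generated twisted module `T`. -/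
def IsWeakEquivalenceII {M N : CurvedModule A} (f : homDeg M N 0) : Prop :=
  IsClosedHom f ∧ ∀ T : CurvedModule A, T.IsFGTwisted →
    DGCategory.IsQuasiIso k (C := CurvedModule A) (C' := CurvedModule A) (X := T) (Y := M)
      (X' := T) (Y' := N) (fun n => homComp T M N 0 n n (zero_add n) f)

/-- A curved module `M` is cofibrant of the second kind if `0 → M` has the left lifting property
with respect to all surjective weak equivalences of the second kind. -/
def IsCofibrantII (M : CurvedModule A) : Prop :=
  ∀ (X Y : CurvedModule A) (p : homDeg X Y 0), IsWeakEquivalenceII p → Function.Surjective p.1 →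
    ∀ f : homDeg M Y 0, IsClosedHom f →
      ∃ g : homDeg M X 0, IsClosedHom g ∧ ∀ m : M, p.1 (g.1 m) = f.1 m

/-- A curved module is perfect of the second kind if it is homotopy equivalent to a direct summand
of a finitely generated twisted module. -/
def IsPerfectII (M : CurvedModule A) : Prop :=
  ∃ N T : CurvedModule A, T.IsFGTwisted ∧ DGCategory.IsDirectSummand k N T ∧
    DGCategory.HomotopyEquivalent k M N

end CurvedModule

/-- The full dg subcategory `Perf^II(A)` of the dg category of curved `A`-modules, on the modules
that are cofibrant and perfect of the second kind. -/
abbrev PerfII {k : Type u} [Field k] (A : CurvedAlgebra k) : Type (u + 1) :=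
  {M : CurvedModule A // M.IsCofibrantII ∧ M.IsPerfectII}

end

/-! The equivalence is Morita theory for a matrix algebra. With `toMatrix`, `A ⊗ End(V)` becomes the
algebra of matrices over `A`, the Koszul signs being absorbed into a sign on each row. Then `x_w` is
closed with square `-w · 1`, so it cancels the curvature; and minus the lower left matrix unit has
differential `1` in `A'`, so multiplying by it contracts `A'`.

For modules, `M ↦ M ⊗ V*` (`row`) followed by the change of differential (`twist`) is bijective on
morphisms of every degree. Every module over the twisted algebra is isomorphic to a value of this
functor, namely at `N e`, for `e` the diagonal matrix unit at a basis vector of degree `0`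
(`row_corner_closedIso`). This is an equivalence between the dg categories of all curved modules.

Restricting it to `Perf^II` requires comparing the finitely generated twisted modules, which test
weak equivalences. They do not correspond exactly: `T ⊗ V*` need not be free over matrices. But `T`
is a summand of `V ⊗ T` (`isDirectSummand_column`), and `V ⊗ T ⊗ V*` is free on a basis of `T`
(`IsFGTwisted.row_column`). Conversely `N e` is finitely generated twisted if `N` is
(`IsFGTwisted.corner`). Agreement up to summands suffices, since the quasi-isomorphism test passes
to summands (`IsQuasiIso.of_isDirectSummand`). So weak equivalences, cofibrancy and perfection all
match (`exists_quasiEquivalence_perfII`). -/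

noncomputable section

/-! ### Homotopy equivalences, summands and quasi-isomorphisms in a dg category. -/

namespace DGCategory

variable {k : Type u} [Field k] {C : Type*} [DGCategory.{u} k C]

theorem d_comp_of_right_closed {X Y Z : C} {i j : ℤ} (h : i + 1 = j) (g : Hom k Y Z i)
    {f : Hom k X Y 0} (hf : d 0 1 rfl f = 0) :
    d i j h (comp (add_zero i) g f) = comp (add_zero j) (d i j h g) f := by
  subst h
  have hf' : d 0 (0 + 1) rfl f = 0 := hf
  rw [leibniz, hf', map_zero, smul_zero, add_zero]

theorem d_comp_of_left_closed {X Y Z : C} {i j : ℤ} (h : i + 1 = j) {g : Hom k Y Z 0}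
    (f : Hom k X Y i) (hg : d 0 1 rfl g = 0) :
    d i j h (comp (zero_add i) g f) = comp (zero_add j) g (d i j h f) := by
  subst h
  have hg' : d 0 (0 + 1) rfl g = 0 := hg
  rw [leibniz, hg', map_zero, LinearMap.zero_apply, zero_add, Int.negOnePow_zero, one_smul]

theorem closed_comp {X Y Z : C} {g : Hom k Y Z 0} {f : Hom k X Y 0} (hg : d 0 1 rfl g = 0)
    (hf : d 0 1 rfl f = 0) : d 0 1 rfl (comp (add_zero 0) g f) = 0 := by
  rw [d_comp_of_right_closed (zero_add 1) g hf, hg, map_zero, LinearMap.zero_apply]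

variable (k) in
/-- `X` and `Y` are isomorphic by closed morphisms of degree `0`. -/
def ClosedIso (X Y : C) : Prop :=
  ∃ (f : Hom k X Y 0) (g : Hom k Y X 0), d 0 1 rfl f = 0 ∧ d 0 1 rfl g = 0 ∧
    comp (add_zero 0) g f = DGCategory.id X ∧ comp (add_zero 0) f g = DGCategory.id Y

theorem ClosedIso.symm {X Y : C} (h : ClosedIso k X Y) : ClosedIso k Y X := by
  obtain ⟨f, g, hf, hg, h1, h2⟩ := h
  exact ⟨g, f, hg, hf, h2, h1⟩

theorem ClosedIso.isDirectSummand {X Y : C} (h : ClosedIso k X Y) : IsDirectSummand k X Y := by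
  obtain ⟨f, g, hf, hg, h1, h2⟩ := h
  exact ⟨f, g, hf, hg, h1⟩

theorem ClosedIso.homotopyEquivalent {X Y : C} (h : ClosedIso k X Y) :
    HomotopyEquivalent k X Y := by
  obtain ⟨f, g, hf, hg, h1, h2⟩ := h
  exact ⟨f, g, hf, hg, ⟨0, by rw [h1, map_zero, sub_self]⟩, ⟨0, by rw [h2, map_zero, sub_self]⟩⟩

theorem IsDirectSummand.trans {X Y Z : C} (h : IsDirectSummand k X Y)
    (h' : IsDirectSummand k Y Z) : IsDirectSummand k X Z := by
  obtain ⟨s, r, hs, hr, e⟩ := h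
  obtain ⟨s', r', hs', hr', e'⟩ := h'
  refine ⟨comp (add_zero 0) s' s, comp (add_zero 0) r r', closed_comp hs' hs,
    closed_comp hr hr', ?_⟩
  rw [← assoc (add_zero 0) (add_zero 0) (add_zero 0) (add_zero 0) r r',
    assoc (add_zero 0) (add_zero 0) (add_zero 0) (add_zero 0) r' s', e', id_comp, e]

theorem HomotopyEquivalent.symm {X Y : C} (h : HomotopyEquivalent k X Y) :
    HomotopyEquivalent k Y X := by
  obtain ⟨f, g, hf, hg, h1, h2⟩ := h
  exact ⟨g, f, hg, hf, h2, h1⟩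

/-- Half of transitivity, stated so that it serves both composites. If `s` contracts `g f - 1` and
`t` contracts `g' f' - 1`, then `s + g t f` contracts `g g' f' f - 1`, because `g` and `f` are
closed. -/
theorem comp_homotopic_id {X Y Z : C} {f : Hom k X Y 0} {g : Hom k Y X 0} {f' : Hom k Y Z 0}
    {g' : Hom k Z Y 0} (hf : d 0 1 rfl f = 0) (hg : d 0 1 rfl g = 0)
    (h : ∃ s : Hom k X X (-1), d (-1) 0 rfl s = comp (add_zero 0) g f - DGCategory.id X)
    (h' : ∃ s : Hom k Y Y (-1), d (-1) 0 rfl s = comp (add_zero 0) g' f' - DGCategory.id Y) :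
    ∃ s : Hom k X X (-1), d (-1) 0 rfl s =
      comp (add_zero 0) (comp (add_zero 0) g g') (comp (add_zero 0) f' f) - DGCategory.id X := by
  obtain ⟨s, hs⟩ := h
  obtain ⟨t, ht⟩ := h'
  refine ⟨s + comp (zero_add (-1)) g (comp (add_zero (-1)) t f), ?_⟩
  rw [map_add, d_comp_of_left_closed (neg_add_cancel 1) _ hg,
    d_comp_of_right_closed (neg_add_cancel 1) _ hf, hs, ht, map_sub,
    LinearMap.sub_apply, map_sub, id_comp,
    ← assoc (add_zero 0) (add_zero 0) (add_zero 0) (add_zero 0) g' f',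
    assoc (add_zero 0) (add_zero 0) (add_zero 0) (add_zero 0) g g']
  abel

theorem HomotopyEquivalent.trans {X Y Z : C} (h : HomotopyEquivalent k X Y)
    (h' : HomotopyEquivalent k Y Z) : HomotopyEquivalent k X Z := by
  obtain ⟨f, g, hf, hg, h1, h2⟩ := h
  obtain ⟨f', g', hf', hg', h1', h2'⟩ := h'
  exact ⟨comp (add_zero 0) f' f, comp (add_zero 0) g g', closed_comp hf' hf, closed_comp hg hg',
    comp_homotopic_id hf hg h1 h1', comp_homotopic_id hg' hf' h2' h2⟩

/-- A closed morphism of degree `0` inducing a quasi-isomorphism on morphisms out of `T` also does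
so on morphisms out of each direct summand of `T`. -/
theorem IsQuasiIso.of_isDirectSummand {S T X Y : C} {f : Hom k X Y 0} (hf : d 0 1 rfl f = 0)
    (hST : IsDirectSummand k S T)
    (h : IsQuasiIso k (X := T) (Y := X) (X' := T) (Y' := Y) fun n => comp (zero_add n) f) :
    IsQuasiIso k (X := S) (Y := X) (X' := S) (Y' := Y) fun n => comp (zero_add n) f := by
  obtain ⟨s, r, hs, hr, e⟩ := hST
  have key : ∀ {W : C} {n : ℤ} (g : Hom k S W n),
      comp (add_zero n) (comp (add_zero n) g r) s = g := fun {W n} g => by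
    rw [← assoc (add_zero 0) (add_zero n) (add_zero n) (add_zero n), e, comp_id]
  -- Both problems are carried from `S` to `T` by precomposing with `r`, solved there, and brought
  -- back by precomposing with `s`. Composition with `f` on the other side is unaffected.
  refine ⟨fun i j hij g => (d_comp_of_left_closed hij g hf).symm, ?_, ?_⟩
  · rintro i j l hij hjl g hg ⟨g', hg'⟩
    obtain ⟨v, hv⟩ := h.2.1 i j l hij hjl (comp (add_zero j) g r)
      (by rw [d_comp_of_right_closed hjl g hr, hg, map_zero, LinearMap.zero_apply])
      ⟨comp (add_zero i) g' r, by
        rw [d_comp_of_right_closed hij g' hr, hg',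
          ← assoc (add_zero j) (zero_add j) (zero_add j) (add_zero j)]⟩
    exact ⟨comp (add_zero i) v s, by rw [d_comp_of_right_closed hij v hs, hv, key]⟩
  · intro i j l hij hjl f' hf'
    obtain ⟨v, hv, u, hu⟩ := h.2.2 i j l hij hjl (comp (add_zero j) f' r)
      (by rw [d_comp_of_right_closed hjl f' hr, hf', map_zero, LinearMap.zero_apply])
    refine ⟨comp (add_zero j) v s, ?_, comp (add_zero i) u s, ?_⟩
    · rw [d_comp_of_right_closed hjl v hs, hv, map_zero, LinearMap.zero_apply]
    · rw [d_comp_of_right_closed hij u hs, hu, map_sub, LinearMap.sub_apply, key,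
        ← assoc (add_zero j) (zero_add j) (zero_add j) (add_zero j)]

theorem IsQuasiIso.of_bijective {C' : Type*} [DGCategory.{u} k C'] {X Y : C} {X' Y' : C'}
    (φ : ∀ n, Hom k X Y n →ₗ[k] Hom k X' Y' n)
    (hd : ∀ i j (h : i + 1 = j) (f : Hom k X Y i), φ j (d i j h f) = d i j h (φ i f))
    (hφ : ∀ n, Function.Bijective (φ n)) : IsQuasiIso k φ := by
  refine ⟨hd, ?_, ?_⟩
  · rintro i j l hij hjl f hf ⟨g', hg'⟩
    obtain ⟨g, rfl⟩ := (hφ i).2 g'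
    exact ⟨g, (hφ j).1 (by rw [hd, hg'])⟩
  · intro i j l hij hjl f' hf'
    obtain ⟨f, rfl⟩ := (hφ j).2 f'
    exact ⟨f, (hφ l).1 (by rw [hd, hf', map_zero]), 0, by rw [map_zero, sub_self]⟩

theorem IsQuasiIso.trans {C' C'' : Type*} [DGCategory.{u} k C'] [DGCategory.{u} k C''] {X Y : C}
    {X' Y' : C'} {X'' Y'' : C''} {φ : ∀ n, Hom k X Y n →ₗ[k] Hom k X' Y' n}
    {ψ : ∀ n, Hom k X' Y' n →ₗ[k] Hom k X'' Y'' n} (hφ : IsQuasiIso k φ) (hψ : IsQuasiIso k ψ) :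
    IsQuasiIso k fun n => ψ n ∘ₗ φ n := by
  refine ⟨fun i j h f => ?_, fun i j l hij hjl f hf hg => ?_, fun i j l hij hjl f' hf' => ?_⟩
  · rw [LinearMap.comp_apply, hφ.1, hψ.1, LinearMap.comp_apply]
  · exact hφ.2.1 i j l hij hjl f hf
      (hψ.2.1 i j l hij hjl (φ j f) (by rw [← hφ.1, hf, map_zero]) hg)
  · obtain ⟨f, hf, g'', hg''⟩ := hψ.2.2 i j l hij hjl f' hf'
    obtain ⟨e, he, g', hg'⟩ := hφ.2.2 i j l hij hjl f hf
    refine ⟨e, he, g'' + ψ i g', ?_⟩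
    rw [map_add, hg'', ← hψ.1, hg', map_sub, LinearMap.comp_apply]
    abel

theorem IsQuasiIso.of_closedIso {T X Y : C} {f : Hom k X Y 0} {g : Hom k Y X 0}
    (hf : d 0 1 rfl f = 0) (h1 : comp (add_zero 0) g f = DGCategory.id X)
    (h2 : comp (add_zero 0) f g = DGCategory.id Y) :
    IsQuasiIso k (X := T) (Y := X) (X' := T) (Y' := Y) fun n => comp (zero_add n) f := by
  refine IsQuasiIso.of_bijective _ (fun i j hij g => (d_comp_of_left_closed hij g hf).symm)
    fun n => Function.bijective_iff_has_inverse.2 ⟨comp (zero_add n) g, fun e => ?_, fun e => ?_⟩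
  · rw [assoc (zero_add n) (zero_add n) (add_zero 0) (zero_add n), h1, id_comp]
  · rw [assoc (zero_add n) (zero_add n) (add_zero 0) (zero_add n), h2, id_comp]

end DGCategory

/-! ### Fully faithful dg functors reflect the structure of a dg category. -/

namespace DGFunctor

open DGCategory

variable {k : Type u} [Field k] {C D : Type*} [DGCategory.{u} k C] [DGCategory.{u} k D]
  (F : DGFunctor k C D)

theorem map_closed {X Y : C} {f : Hom k X Y 0} (hf : d 0 1 rfl f = 0) :
    d 0 1 rfl (F.map 0 f) = 0 := by
  rw [← F.map_d, hf, map_zero]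

theorem map_isDirectSummand {X Y : C} (h : IsDirectSummand k X Y) :
    IsDirectSummand k (F.obj X) (F.obj Y) := by
  obtain ⟨s, r, hs, hr, e⟩ := h
  exact ⟨F.map 0 s, F.map 0 r, F.map_closed hs, F.map_closed hr, by rw [← F.map_comp, e, F.map_id]⟩

theorem map_homotopyEquivalent {X Y : C} (h : HomotopyEquivalent k X Y) :
    HomotopyEquivalent k (F.obj X) (F.obj Y) := by
  obtain ⟨f, g, hf, hg, ⟨s, hs⟩, ⟨t, ht⟩⟩ := h
  exact ⟨F.map 0 f, F.map 0 g, F.map_closed hf, F.map_closed hg,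
    ⟨F.map (-1) s, by rw [← F.map_d, hs, map_sub, F.map_comp, F.map_id]⟩,
    ⟨F.map (-1) t, by rw [← F.map_d, ht, map_sub, F.map_comp, F.map_id]⟩⟩

/-- A dg functor is fully faithful if it is bijective on morphisms of every degree. -/
def FullyFaithful : Prop := ∀ (X Y : C) (n : ℤ), Function.Bijective (F.map (X := X) (Y := Y) n)

variable {F}

/-- Surjectivity in degree `0` gives the preimage; injectivity in degree `1` makes it closed. -/
theorem FullyFaithful.exists_closed (hF : F.FullyFaithful) {X Y : C}
    {f : Hom k (F.obj X) (F.obj Y) 0} (hf : d 0 1 rfl f = 0) :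
    ∃ g : Hom k X Y 0, d 0 1 rfl g = 0 ∧ F.map 0 g = f := by
  obtain ⟨g, rfl⟩ := (hF X Y 0).2 f
  exact ⟨g, (hF X Y 1).1 (by rw [F.map_d, hf, map_zero]), rfl⟩

theorem FullyFaithful.isDirectSummand (hF : F.FullyFaithful) {X Y : C}
    (h : IsDirectSummand k (F.obj X) (F.obj Y)) : IsDirectSummand k X Y := by
  obtain ⟨s, r, hs, hr, e⟩ := h
  obtain ⟨s, hs', rfl⟩ := hF.exists_closed hs
  obtain ⟨r, hr', rfl⟩ := hF.exists_closed hr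
  exact ⟨s, r, hs', hr', (hF X X 0).1 (by rw [F.map_comp, e, F.map_id])⟩

theorem FullyFaithful.homotopyEquivalent (hF : F.FullyFaithful) {X Y : C}
    (h : HomotopyEquivalent k (F.obj X) (F.obj Y)) : HomotopyEquivalent k X Y := by
  obtain ⟨f, g, hf, hg, ⟨s, hs⟩, ⟨t, ht⟩⟩ := h
  obtain ⟨f, hf', rfl⟩ := hF.exists_closed hf
  obtain ⟨g, hg', rfl⟩ := hF.exists_closed hg
  obtain ⟨s, rfl⟩ := (hF X X (-1)).2 s
  obtain ⟨t, rfl⟩ := (hF Y Y (-1)).2 t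
  exact ⟨f, g, hf', hg',
    ⟨s, (hF X X 0).1 (by rw [F.map_d, hs, map_sub, F.map_comp, F.map_id])⟩,
    ⟨t, (hF Y Y 0).1 (by rw [F.map_d, ht, map_sub, F.map_comp, F.map_id])⟩⟩

/-- A fully faithful dg functor preserves and reflects quasi-isomorphisms on morphisms
out of an object. -/
theorem FullyFaithful.isQuasiIso_comp_iff (hF : F.FullyFaithful) {T X Y : C} (f : Hom k X Y 0) :
    IsQuasiIso k (X := F.obj T) (Y := F.obj X) (X' := F.obj T) (Y' := F.obj Y)
        (fun n => comp (zero_add n) (F.map 0 f)) ↔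
      IsQuasiIso k (X := T) (Y := X) (X' := T) (Y' := Y) (fun n => comp (zero_add n) f) := by
  constructor
  · rintro ⟨h1, h2, h3⟩
    refine ⟨fun i j hij g => (hF _ _ j).1 ?_, ?_, ?_⟩
    · rw [F.map_comp, F.map_d, F.map_d, F.map_comp]
      exact h1 i j hij _
    · rintro i j l hij hjl g hg ⟨g', hg'⟩
      obtain ⟨v, hv⟩ := h2 i j l hij hjl (F.map j g) (by rw [← F.map_d, hg, map_zero])
        ⟨F.map i g', by rw [← F.map_d, hg', F.map_comp]⟩
      obtain ⟨v, rfl⟩ := (hF _ _ i).2 v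
      exact ⟨v, (hF _ _ j).1 (by rw [F.map_d, hv])⟩
    · intro i j l hij hjl f' hf'
      obtain ⟨v, hv, u, hu⟩ := h3 i j l hij hjl (F.map j f') (by rw [← F.map_d, hf', map_zero])
      obtain ⟨v, rfl⟩ := (hF _ _ j).2 v
      obtain ⟨u, rfl⟩ := (hF _ _ i).2 u
      exact ⟨v, (hF _ _ l).1 (by rw [F.map_d, hv, map_zero]), u,
        (hF _ _ j).1 (by rw [F.map_d, hu, map_sub, F.map_comp])⟩
  · rintro ⟨h1, h2, h3⟩
    refine ⟨fun i j hij g => ?_, ?_, ?_⟩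
    · obtain ⟨g, rfl⟩ := (hF _ _ i).2 g
      rw [← F.map_comp, ← F.map_d, ← F.map_d, ← F.map_comp]
      exact congrArg _ (h1 i j hij _)
    · rintro i j l hij hjl g hg ⟨g', hg'⟩
      obtain ⟨g, rfl⟩ := (hF _ _ j).2 g
      obtain ⟨g', rfl⟩ := (hF _ _ i).2 g'
      obtain ⟨v, hv⟩ := h2 i j l hij hjl g ((hF _ _ l).1 (by rw [F.map_d, hg, map_zero]))
        ⟨g', (hF _ _ j).1 (by rw [F.map_d, hg', F.map_comp])⟩
      exact ⟨F.map i v, by rw [← F.map_d, hv]⟩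
    · intro i j l hij hjl f' hf'
      obtain ⟨f', rfl⟩ := (hF _ _ j).2 f'
      obtain ⟨v, hv, u, hu⟩ := h3 i j l hij hjl f' ((hF _ _ l).1 (by rw [F.map_d, hf', map_zero]))
      exact ⟨F.map j v, by rw [← F.map_d, hv, map_zero], F.map i u,
        by rw [← F.map_d, hu, map_sub, F.map_comp]⟩

end DGFunctor

/-! ### Transfer of weak equivalences, cofibrancy and perfection along an equivalence. -/

namespace CurvedModule

open DGCategory

variable {k : Type u} [Field k] {A B : CurvedAlgebra k}

theorem homDeg_ext {M N : CurvedModule A} {n : ℤ} {f g : homDeg M N n}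
    (h : ∀ m : M, f.1 m = g.1 m) : f = g :=
  Subtype.ext (LinearMap.ext h)

theorem isClosedHom_iff {M N : CurvedModule A} (f : homDeg M N 0) :
    IsClosedHom f ↔ DGCategory.d (k := k) (C := CurvedModule A) (X := M) (Y := N) 0 1 rfl f = 0 := by
  have key : ∀ m : M, ((homD M N 0 1 rfl f).1 m : N) = N.d (f.1 m) - f.1 (M.d m) := fun m => by
    change N.d (f.1 m) - (0 : ℤ).negOnePow • f.1 (M.d m) = _
    rw [Int.negOnePow_zero, one_smul]
  constructor
  · intro h
    refine homDeg_ext fun m => ?_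
    exact (key m).trans (by rw [h m, sub_self]; rfl)
  · intro h m
    have h' : (homD M N 0 1 rfl f).1 m = 0 := by
      change homD M N 0 1 rfl f = 0 at h
      rw [h]; rfl
    exact sub_eq_zero.1 ((key m).symm.trans h')

/-- A closed morphism with a two-sided inverse that preserves degrees is an isomorphism. -/
theorem closedIso_of_inverse {M N : CurvedModule A} (f : homDeg M N 0) (hf : IsClosedHom f)
    (g : N → M) (hg : ∀ (i : ℤ) (n : N), n ∈ N.deg i → g n ∈ M.deg i)
    (h1 : ∀ m : M, g (f.1 m) = m) (h2 : ∀ n : N, f.1 (g n) = n) : ClosedIso k M N := by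
  let g' : homDeg N M 0 :=
    ⟨{ toFun := g
       map_add' := fun m n => by
        conv_lhs => rw [← h2 m, ← h2 n, ← map_add, h1]
       map_smul' := fun a n => by
        conv_lhs => rw [← h2 n, ← map_smul, h1]
        rfl }, fun i n hn => by
      rw [add_zero]
      exact hg i n hn⟩
  refine ⟨f, g', (isClosedHom_iff f).1 hf, (isClosedHom_iff g').1 fun n => ?_,
    homDeg_ext h1, homDeg_ext h2⟩
  change M.d (g n) = g (N.d n)
  rw [← h1 (M.d (g n)), ← hf, h2]

theorem ClosedIso.exists_hom {M N : CurvedModule A} (h : ClosedIso k M N) :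
    ∃ (f : homDeg M N 0) (g : homDeg N M 0), IsClosedHom f ∧ IsClosedHom g ∧
      (∀ m : M, g.1 (f.1 m) = m) ∧ ∀ n : N, f.1 (g.1 n) = n := by
  obtain ⟨f, g, hf, hg, h1, h2⟩ := h
  exact ⟨f, g, (isClosedHom_iff f).2 hf, (isClosedHom_iff g).2 hg,
    fun m => congrArg (fun e : homDeg M M 0 => e.1 m) h1,
    fun n => congrArg (fun e : homDeg N N 0 => e.1 n) h2⟩

/-- The composite of two morphisms of degree `0`. -/
abbrev comp₀ {M N P : CurvedModule A} (g : homDeg N P 0) (f : homDeg M N 0) : homDeg M P 0 :=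
  homComp M N P 0 0 0 (add_zero 0) g f

theorem IsClosedHom.comp {M N P : CurvedModule A} {g : homDeg N P 0} {f : homDeg M N 0}
    (hg : IsClosedHom g) (hf : IsClosedHom f) : IsClosedHom (comp₀ g f) :=
  fun m => (hg (f.1 m)).trans (congrArg g.1 (hf m))

theorem ClosedIso.isWeakEquivalenceII {M N : CurvedModule A} {f : homDeg M N 0}
    {g : homDeg N M 0} (hf : IsClosedHom f) (h1 : ∀ m : M, g.1 (f.1 m) = m)
    (h2 : ∀ n : N, f.1 (g.1 n) = n) : IsWeakEquivalenceII f :=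
  ⟨hf, fun _ _ => IsQuasiIso.of_closedIso (g := g) ((isClosedHom_iff f).1 hf)
    (homDeg_ext h1) (homDeg_ext h2)⟩

theorem IsWeakEquivalenceII.comp {M N P : CurvedModule A} {g : homDeg N P 0} {f : homDeg M N 0}
    (hg : IsWeakEquivalenceII g) (hf : IsWeakEquivalenceII f) :
    IsWeakEquivalenceII (comp₀ g f) :=
  ⟨hg.1.comp hf.1, fun T hT => (hf.2 T hT).trans (hg.2 T hT)⟩

theorem IsCofibrantII.of_closedIso {M N : CurvedModule A} (hM : M.IsCofibrantII)
    (h : ClosedIso k M N) : N.IsCofibrantII := by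
  obtain ⟨a, b, ha, hb, hba, hab⟩ := ClosedIso.exists_hom h
  intro X Y p hp hs f hf
  obtain ⟨g, hg, hpg⟩ := hM X Y p hp hs (comp₀ f a) (hf.comp ha)
  refine ⟨comp₀ g b, hg.comp hb, fun n => ?_⟩
  exact (hpg (b.1 n)).trans (congrArg f.1 (hab n))

theorem IsPerfectII.of_homotopyEquivalent {M N : CurvedModule A} (hM : M.IsPerfectII)
    (h : HomotopyEquivalent k M N) : N.IsPerfectII := by
  obtain ⟨S, T, hT, hS, hMS⟩ := hM
  exact ⟨S, T, hT, hS, h.symm.trans hMS⟩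

/-- Full faithfulness settles the test on objects `F T`. The two hypotheses place each test object
of one side, up to `F`, as a summand of a test object of the other, and the test descends to
summands. -/
theorem isWeakEquivalenceII_map_iff
    {F : DGFunctor k (CurvedModule A) (CurvedModule B)} (hF : F.FullyFaithful)
    (hfg : ∀ T : CurvedModule A, T.IsFGTwisted →
      ∃ T' : CurvedModule B, T'.IsFGTwisted ∧ IsDirectSummand k (F.obj T) T')
    (hfg' : ∀ T' : CurvedModule B, T'.IsFGTwisted →
      ∃ T : CurvedModule A, T.IsFGTwisted ∧ IsDirectSummand k T' (F.obj T))
    {M N : CurvedModule A} (p : homDeg M N 0) :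
    IsWeakEquivalenceII (M := F.obj M) (N := F.obj N) (F.map 0 p) ↔ IsWeakEquivalenceII p := by
  constructor
  · rintro ⟨hc, h⟩
    have hc' : IsClosedHom p := (isClosedHom_iff p).2 <| (hF M N 1).1 <| by
      rw [F.map_d, map_zero]; exact (isClosedHom_iff _).1 hc
    refine ⟨hc', fun T hT => ?_⟩
    obtain ⟨T', hT', hs⟩ := hfg T hT
    exact (hF.isQuasiIso_comp_iff p).1
      (IsQuasiIso.of_isDirectSummand ((isClosedHom_iff _).1 hc) hs (h T' hT'))
  · rintro ⟨hc, h⟩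
    have hc' := F.map_closed ((isClosedHom_iff p).1 hc)
    refine ⟨(isClosedHom_iff _).2 hc', fun T' hT' => ?_⟩
    obtain ⟨T, hT, hs⟩ := hfg' T' hT'
    exact IsQuasiIso.of_isDirectSummand hc' hs ((hF.isQuasiIso_comp_iff p).2 (h T hT))

/-- A fully faithful and essentially surjective dg functor of curved modules that preserves and
reflects surjections, and that matches finitely generated twisted modules up to direct summands,
restricts to a quasi-equivalence of the dg categories `Perf^II`. -/
theorem exists_quasiEquivalence_perfII
    (F : DGFunctor k (CurvedModule A) (CurvedModule B)) (hF : F.FullyFaithful)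
    (hsurj : ∀ {M N : CurvedModule A} (p : homDeg M N 0) (p' : homDeg (F.obj M) (F.obj N) 0),
      F.map 0 p = p' → (Function.Surjective p'.1 ↔ Function.Surjective p.1))
    (hess : ∀ N : CurvedModule B, ∃ M : CurvedModule A, ClosedIso k (F.obj M) N)
    (hfg : ∀ T : CurvedModule A, T.IsFGTwisted →
      ∃ T' : CurvedModule B, T'.IsFGTwisted ∧ IsDirectSummand k (F.obj T) T')
    (hfg' : ∀ T' : CurvedModule B, T'.IsFGTwisted →
      ∃ T : CurvedModule A, T.IsFGTwisted ∧ IsDirectSummand k T' (F.obj T)) :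
    ∃ G : DGFunctor k (PerfII A) (PerfII B), G.IsQuasiEquivalence := by
  have hweq := fun {M N} => isWeakEquivalenceII_map_iff hF hfg hfg' (M := M) (N := N)
  have hcof : ∀ M : CurvedModule A, M.IsCofibrantII → (F.obj M).IsCofibrantII := by
    intro M hM X' Y' p' hp' hs' f' hf'
    -- The lifting problem lives among arbitrary `B`-modules, so its source and target are first
    -- replaced by isomorphic modules in the image of `F`; the problem can then be pulled back to
    -- `A`.
    obtain ⟨X, hX⟩ := hess X'
    obtain ⟨Y, hY⟩ := hess Y'
    obtain ⟨a, a', ha, ha', haa, haa'⟩ := ClosedIso.exists_hom hX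
    obtain ⟨b, b', hb, hb', hbb, hbb'⟩ := ClosedIso.exists_hom hY
    obtain ⟨p, hp⟩ := (hF X Y 0).2 (comp₀ b' (comp₀ p' a))
    obtain ⟨f, hf, hf2⟩ := hF.exists_closed (f := comp₀ b' f') ((isClosedHom_iff _).1 (hb'.comp hf'))
    have hpw : IsWeakEquivalenceII p := (hweq p).1 <| by
      rw [hp]
      exact (ClosedIso.isWeakEquivalenceII hb' hbb' hbb).comp
        (hp'.comp (ClosedIso.isWeakEquivalenceII ha haa haa'))
    have hps : Function.Surjective p.1 := (hsurj p _ hp).1 <|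
      (Function.LeftInverse.surjective hbb).comp
        (hs'.comp (Function.LeftInverse.surjective haa'))
    obtain ⟨g, hg, hpg⟩ := hM X Y p hpw hps f ((isClosedHom_iff f).2 hf)
    refine ⟨comp₀ a (F.map 0 g), ha.comp ((isClosedHom_iff _).2
      (F.map_closed ((isClosedHom_iff g).1 hg))), fun m => ?_⟩
    have h1 : comp₀ (comp₀ b' (comp₀ p' a)) (F.map 0 g) = comp₀ b' f' := by
      rw [← hf2, ← hp]
      refine (F.map_comp (add_zero 0) p g).symm.trans (congrArg (F.map 0) ?_)
      exact homDeg_ext hpg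
    -- `h1` is the lifting identity after composition with the isomorphism `b'`; applying `b`
    -- removes it.
    have h2 := congrArg (fun e : homDeg (F.obj M) (F.obj Y) 0 => b.1 (e.1 m)) h1
    exact (hbb' _).symm.trans (h2.trans (hbb' _))
  have hcof' : ∀ M : CurvedModule A, (F.obj M).IsCofibrantII → M.IsCofibrantII := by
    intro M hM X Y p hp hs f hf
    -- In this direction the lifting problem starts over `A`, so `F` applies to it directly and no
    -- replacement is needed.
    obtain ⟨g', hg', hpg⟩ := hM (F.obj X) (F.obj Y) (F.map 0 p) ((hweq p).2 hp) ((hsurj p _ rfl).2 hs)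
      (F.map 0 f) ((isClosedHom_iff _).2 (F.map_closed ((isClosedHom_iff f).1 hf)))
    obtain ⟨g, hg, rfl⟩ := hF.exists_closed ((isClosedHom_iff g').1 hg')
    refine ⟨g, (isClosedHom_iff g).2 hg, fun m => ?_⟩
    have h1 : comp₀ p g = f := (hF M Y 0).1 <|
      (F.map_comp (add_zero 0) p g).trans (homDeg_ext hpg)
    exact congrArg (fun e : homDeg M Y 0 => e.1 m) h1
  have hperf : ∀ M : CurvedModule A, M.IsPerfectII → (F.obj M).IsPerfectII := by
    rintro M ⟨S, T, hT, hS, hMS⟩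
    obtain ⟨T', hT', hs⟩ := hfg T hT
    exact ⟨F.obj S, T', hT', (F.map_isDirectSummand hS).trans hs, F.map_homotopyEquivalent hMS⟩
  have hperf' : ∀ M : CurvedModule A, (F.obj M).IsPerfectII → M.IsPerfectII := by
    rintro M ⟨S', T', hT', hS', hMS⟩
    obtain ⟨T, hT, hs⟩ := hfg' T' hT'
    -- The intermediate summand `S'` must itself come from `A` before the summand and homotopy data
    -- can be reflected.
    obtain ⟨S, hS⟩ := hess S'
    exact ⟨S, T, hT, hF.isDirectSummand ((hS.isDirectSummand.trans hS').trans hs),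
      hF.homotopyEquivalent (hMS.trans hS.symm.homotopyEquivalent)⟩
  refine ⟨{ obj := fun M => ⟨F.obj M.1, hcof _ M.2.1, hperf _ M.2.2⟩
            map := fun {X Y} n => F.map (X := X.1) (Y := Y.1) n
            map_d := fun i j h f => F.map_d i j h f
            map_id := fun X => F.map_id X.1
            map_comp := fun h g f => F.map_comp h g f }, ?_, ?_⟩
  · intro X Y
    exact IsQuasiIso.of_bijective _ (fun i j h f => F.map_d i j h f) fun n => hF X.1 Y.1 n
  · rintro ⟨Z, hZc, hZp⟩
    obtain ⟨M, hM⟩ := hess Z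
    refine ⟨⟨M, hcof' M (hZc.of_closedIso hM.symm),
      hperf' M (hZp.of_homotopyEquivalent hM.symm.homotopyEquivalent)⟩, ?_⟩
    exact hM.homotopyEquivalent

end CurvedModule

/-! ### The algebra `A ⊗ End(V)` as matrices over `A`. -/

namespace CurvedAlgebra

variable {k : Type u} [Field k]

section Sign

variable (A : CurvedAlgebra k) (p : ℤ)

/-- The automorphism `a ↦ (-1)^(p |a|) a`. -/
def sign : A →ₗ[k] A :=
  (DirectSum.toModule k ℤ A fun i => (p * i).negOnePow • (A.deg i).subtype) ∘ₗ
    (DirectSum.decomposeLinearEquiv A.deg).toLinearMap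

theorem sign_of_mem {i : ℤ} {a : A} (ha : a ∈ A.deg i) :
    A.sign p a = (p * i).negOnePow • a := by
  lift a to A.deg i using ha
  simp [sign]

theorem sign_mem {i : ℤ} {a : A} (ha : a ∈ A.deg i) : A.sign p a ∈ A.deg i := by
  rw [A.sign_of_mem p ha]
  exact (A.deg i).smul_of_tower_mem _ ha

theorem sign_one : A.sign p 1 = 1 := by
  rw [A.sign_of_mem p SetLike.GradedOne.one_mem, mul_zero, Int.negOnePow_zero, one_smul]

theorem sign_of_mem_even {i : ℤ} (hi : Even i) {a : A} (ha : a ∈ A.deg i) : A.sign p a = a := by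
  rw [A.sign_of_mem p ha, Int.negOnePow_even _ (hi.mul_left p), one_smul]

theorem sign_sign (a : A) : A.sign p (A.sign p a) = a := by
  induction a using A.hom_induction with
  | h0 => simp
  | add a b ha hb => rw [map_add, map_add, ha, hb]
  | hom i a ha =>
    rw [A.sign_of_mem p ha, LinearMap.map_smul_of_tower, A.sign_of_mem p ha, smul_smul,
      Int.units_mul_self, one_smul]

theorem sign_mul (a b : A) : A.sign p (a * b) = A.sign p a * A.sign p b := by
  induction a using A.hom_induction with
  | h0 => simp
  | add a a' h h' => rw [add_mul, map_add, h, h', map_add, add_mul]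
  | hom i a ha =>
    induction b using A.hom_induction with
    | h0 => simp
    | add b b' h h' => rw [mul_add, map_add, h, h', map_add, mul_add]
    | hom j b hb =>
      rw [A.sign_of_mem p ha, A.sign_of_mem p hb, A.sign_of_mem p (SetLike.mul_mem_graded ha hb),
        mul_add, Int.negOnePow_add, smul_mul_smul_comm]

/-- Since `d` raises degree by one, it commutes with the sign only up to `(-1)^p`. This is the
source of the row signs in `toMatrix_d`. -/
theorem d_sign (a : A) : A.d (A.sign p a) = p.negOnePow • A.sign p (A.d a) := by
  induction a using A.hom_induction with
  | h0 => simp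
  | add a b ha hb => rw [map_add, map_add, ha, hb, map_add, map_add, smul_add]
  | hom i a ha =>
    rw [A.sign_of_mem p ha, LinearMap.map_smul_of_tower, A.sign_of_mem p (A.d_mem ha), smul_smul,
      mul_add, mul_one, Int.negOnePow_add, mul_left_comm, Int.units_mul_self, mul_one]

theorem d_one : A.d 1 = 0 := by
  simpa using A.leibniz 1 SetLike.GradedOne.one_mem

end Sign

section Matrix

variable (A : CurvedAlgebra k) {ι : Type} [DecidableEq ι] [Fintype ι] (p : ι → ℤ)

/-- The curved algebra `A ⊗ End(V)` for `V = ⨁ i, k e_i` with `|e_i| = p i`. -/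
abbrev matrixAlgebra : CurvedAlgebra k := A.tensor (endAlgebra p k)

/-- The element `a ⊗ E` of `A ⊗ End(V)`, linearly in `a` and `E`. -/
def endTmul : A →ₗ[k] Matrix ι ι k →ₗ[k] A.matrixAlgebra p :=
  ((TensorProduct.mk k A (Matrix ι ι k)).compr₂
    (GradedTensorProduct.of k A.deg (endDeg p k)).toLinearMap :
    A →ₗ[k] Matrix ι ι k →ₗ[k] (A.deg ᵍ⊗[k] endDeg p k))

theorem endTmul_induction {P : A.matrixAlgebra p → Prop} (h0 : P 0)
    (hom : ∀ (i n : ℤ) (a : A) (E : Matrix ι ι k), a ∈ A.deg i → E ∈ endDeg p k n →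
      P (A.endTmul p a E))
    (add : ∀ y z, P y → P z → P (y + z)) (z : A.matrixAlgebra p) : P z :=
  tensor_hom_induction A (endAlgebra p k) h0 hom add z

theorem endTmul_mul {n i : ℤ} (a : A) {c : A} {E : Matrix ι ι k} (E' : Matrix ι ι k)
    (hE : E ∈ endDeg p k n) (hc : c ∈ A.deg i) :
    A.endTmul p a E * A.endTmul p c E' = (n * i).negOnePow • A.endTmul p (a * c) (E * E') :=
  tmul_mul_tmul A (endAlgebra p k) a c E E' hE hc

theorem d_endTmul (a : A) (E : Matrix ι ι k) :
    (A.matrixAlgebra p).d (A.endTmul p a E) = A.endTmul p (A.d a) E := by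
  induction a using A.hom_induction with
  | h0 => simp
  | add a b ha hb => simp only [map_add, LinearMap.add_apply, ha, hb]
  | hom i a ha =>
    have h := tensorD_tmul A (endAlgebra p k) E ha
    have h0 : i.negOnePow • A.endTmul p a 0 = 0 := by rw [map_zero, smul_zero]
    exact h.trans ((congrArg (A.endTmul p (A.d a) E + ·) h0).trans (add_zero _))

theorem endTmul_mem {i n : ℤ} {a : A} {E : Matrix ι ι k} (ha : a ∈ A.deg i)
    (hE : E ∈ endDeg p k n) : A.endTmul p a E ∈ (A.matrixAlgebra p).deg (i + n) :=
  tmul_mem A (endAlgebra p k) ha hE rfl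

/-- The linear map underlying the isomorphism of `A ⊗ End(V)` with matrices over `A`. -/
def toMatrixLinear : A.matrixAlgebra p →ₗ[k] Matrix ι ι A :=
  (TensorProduct.lift (LinearMap.mk₂ k
    (fun (a : A) (E : Matrix ι ι k) => Matrix.of fun j l => E j l • A.sign (p j) a)
    (fun a b E => by ext; simp)
    (fun c a E => by ext; simp [smul_comm c])
    (fun a E E' => by ext; simp [add_smul])
    (fun c a E => by ext; simp [mul_smul])) ∘ₗ
      (GradedTensorProduct.of k A.deg (endDeg p k)).symm.toLinearMap :
    (A.deg ᵍ⊗[k] endDeg p k) →ₗ[k] Matrix ι ι A)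

theorem toMatrixLinear_endTmul (a : A) (E : Matrix ι ι k) (j l : ι) :
    A.toMatrixLinear p (A.endTmul p a E) j l = E j l • A.sign (p j) a :=
  rfl

/-- The inverse of `toMatrixLinear`. -/
def ofMatrixLinear : Matrix ι ι A →ₗ[k] A.matrixAlgebra p :=
  ∑ j, ∑ l, (A.endTmul p).flip (Matrix.single j l (1 : k)) ∘ₗ A.sign (p j) ∘ₗ
    Matrix.entryLinearMap k A j l

theorem ofMatrixLinear_apply (X : Matrix ι ι A) :
    A.ofMatrixLinear p X = ∑ j, ∑ l, A.endTmul p (A.sign (p j) (X j l)) (Matrix.single j l 1) := by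
  simp only [ofMatrixLinear, LinearMap.sum_apply]
  rfl

theorem toMatrixLinear_ofMatrixLinear (X : Matrix ι ι A) :
    A.toMatrixLinear p (A.ofMatrixLinear p X) = X := by
  ext r s
  rw [ofMatrixLinear_apply]
  simp only [map_sum, Matrix.sum_apply, toMatrixLinear_endTmul, Matrix.single_apply, ite_smul,
    zero_smul, one_smul]
  rw [Finset.sum_eq_single r, Finset.sum_eq_single s] <;> simp +contextual [sign_sign]

theorem ofMatrixLinear_toMatrixLinear (b : A.matrixAlgebra p) :
    A.ofMatrixLinear p (A.toMatrixLinear p b) = b := by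
  induction b using endTmul_induction with
  | h0 => simp
  | add y z hy hz => rw [map_add, map_add, hy, hz]
  | hom i n a E _ _ =>
    rw [ofMatrixLinear_apply]
    conv_rhs => rw [Matrix.matrix_eq_sum_single E]
    simp only [map_sum, toMatrixLinear_endTmul]
    refine Finset.sum_congr rfl fun j _ => Finset.sum_congr rfl fun l _ => ?_
    rw [map_smul, sign_sign, map_smul, LinearMap.smul_apply, ← map_smul, Matrix.smul_single,
      smul_eq_mul, mul_one]

/-- The row sign absorbs the Koszul sign. If `E r t ≠ 0` then `|E| = p r - p t`, so `(|E| + p r)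
|a'|` and `p t |a'|` have the same parity, and the latter is the sign carried by row `t` of the
second factor. -/
theorem toMatrixLinear_mul (b c : A.matrixAlgebra p) :
    A.toMatrixLinear p (b * c) = A.toMatrixLinear p b * A.toMatrixLinear p c := by
  induction b using endTmul_induction with
  | h0 => simp
  | add y z hy hz => rw [add_mul, map_add, hy, hz, map_add, add_mul]
  | hom i n a E ha hE =>
    induction c using endTmul_induction with
    | h0 => simp
    | add y z hy hz => rw [mul_add, map_add, hy, hz, map_add, mul_add]
    | hom i' n' a' E' ha' hE' =>
      rw [endTmul_mul A p a E' hE ha', LinearMap.map_smul_of_tower]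
      ext r s
      rw [Matrix.mul_apply, Matrix.smul_apply, toMatrixLinear_endTmul, Matrix.mul_apply,
        Finset.sum_smul, Finset.smul_sum]
      refine Finset.sum_congr rfl fun t _ => ?_
      rw [toMatrixLinear_endTmul, toMatrixLinear_endTmul]
      by_cases h : E r t = 0
      · simp [h]
      · have hj := hE r t h
        rw [sign_mul, A.sign_of_mem (p t) ha', A.sign_of_mem (p r) ha', smul_mul_smul_comm,
          smul_comm _ (E r t * E' t s), mul_smul_comm, mul_smul_comm, smul_smul,
          ← Int.negOnePow_add]
        congr 2
        rw [← hj, show (p r - p t) * i' + p r * i' = p t * i' + 2 * ((p r - p t) * i') by ring,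
          Int.negOnePow_add, Int.negOnePow_two_mul, mul_one]

/-- The isomorphism of `A ⊗ End(V)` with the algebra of matrices over `A`, which sends `a ⊗ E` to
the matrix with entries `(-1)^(p j |a|) E j l a`. -/
def toMatrix : A.matrixAlgebra p ≃ₐ[k] Matrix ι ι A :=
  AlgEquiv.ofLinearEquiv
    { A.toMatrixLinear p with
      invFun := A.ofMatrixLinear p
      left_inv := A.ofMatrixLinear_toMatrixLinear p
      right_inv := A.toMatrixLinear_ofMatrixLinear p }
    (by
      ext j l
      change A.toMatrixLinear p (A.endTmul p 1 1) j l = _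
      rw [toMatrixLinear_endTmul, sign_one, Matrix.one_apply, Matrix.one_apply]
      split_ifs <;> simp)
    (A.toMatrixLinear_mul p)

theorem toMatrix_endTmul (a : A) (E : Matrix ι ι k) (j l : ι) :
    A.toMatrix p (A.endTmul p a E) j l = E j l • A.sign (p j) a :=
  rfl

theorem toMatrix_d (b : A.matrixAlgebra p) (j l : ι) :
    A.toMatrix p ((A.matrixAlgebra p).d b) j l = (p j).negOnePow • A.d (A.toMatrix p b j l) := by
  induction b using endTmul_induction with
  | h0 => simp
  | add y z hy hz =>
    rw [map_add, map_add, Matrix.add_apply, hy, hz, map_add, Matrix.add_apply, map_add, smul_add]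
  | hom i n a E ha hE =>
    rw [d_endTmul, toMatrix_endTmul, toMatrix_endTmul, map_smul, d_sign, smul_comm _ (E j l),
      smul_smul, Int.units_mul_self, one_smul]

theorem toMatrix_endTmul_mem {i n : ℤ} {a : A} {E : Matrix ι ι k} (ha : a ∈ A.deg i)
    (hE : E ∈ endDeg p k n) (j l : ι) :
    A.toMatrix p (A.endTmul p a E) j l ∈ A.deg (i + n - p j + p l) := by
  rw [toMatrix_endTmul]
  by_cases h : E j l = 0
  · rw [h, zero_smul]; exact zero_mem _
  · rw [← hE j l h, show i + (p j - p l) - p j + p l = i by ring]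
    exact Submodule.smul_mem _ _ (A.sign_mem _ ha)

/-- The elementary matrix at `(j, l)` has degree `p j - p l`, so its coefficient in an element of
degree `n` must make up the difference. -/
theorem mem_deg_iff_toMatrix {b : A.matrixAlgebra p} {n : ℤ} :
    b ∈ (A.matrixAlgebra p).deg n ↔ ∀ j l, A.toMatrix p b j l ∈ A.deg (n - p j + p l) := by
  constructor
  · intro hb
    change b ∈ tensorDeg A (endAlgebra p k) n at hb
    induction hb using Submodule.span_induction with
    | zero =>
      intro j l
      have : A.toMatrix p 0 j l = 0 := by rw [map_zero]; rfl
      exact this ▸ zero_mem _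
    | add y z _ _ h1 h2 =>
      intro j l
      have : A.toMatrix p (y + z) j l = A.toMatrix p y j l + A.toMatrix p z j l := by
        rw [map_add]; rfl
      exact this ▸ add_mem (h1 j l) (h2 j l)
    | smul c y _ h =>
      intro j l
      have : A.toMatrix p (c • y) j l = c • A.toMatrix p y j l := by rw [map_smul]; rfl
      exact this ▸ Submodule.smul_mem _ c (h j l)
    | mem z hz =>
      obtain ⟨i, n, a, E, ha, hE, rfl, rfl⟩ := hz
      exact A.toMatrix_endTmul_mem p ha hE
  · intro h
    rw [← (A.toMatrix p).symm_apply_apply b]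
    change A.ofMatrixLinear p _ ∈ _
    rw [ofMatrixLinear_apply]
    refine sum_mem fun j _ => sum_mem fun l _ => ?_
    have := A.endTmul_mem p (A.sign_mem (p j) (h j l)) (single_mem_endDeg p j l (1 : k) rfl)
    rwa [show n - p j + p l + (p j - p l) = n by ring] at this

/-- `End(V)` contributes no curvature, and `w` has even degree, so no row sign appears. -/
theorem toMatrix_curv : A.toMatrix p (A.matrixAlgebra p).curv = Matrix.scalar ι A.curv := by
  have : (A.matrixAlgebra p).curv = A.endTmul p A.curv 1 := by
    change A.endTmul p A.curv 1 + A.endTmul p 1 0 = _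
    rw [map_zero, add_zero]
  ext j l
  rw [this, toMatrix_endTmul, A.sign_of_mem_even _ even_two A.curv_mem, Matrix.one_apply,
    Matrix.scalar_apply, Matrix.diagonal_apply]
  split_ifs <;> simp

end Matrix

end CurvedAlgebra

/-! ### The twist by `x_w`: vanishing curvature and contractibility. -/

namespace CurvedAlgebra

variable {k : Type u} [Field k]

/-- Left multiplication by `h` is a contracting homotopy: `d (h a) = a - h (d a)`. -/
theorem isAcyclic_of_d_eq_one (A : CurvedAlgebra k) {h : A} (hh : h ∈ A.deg (-1))
    (hd : A.d h = 1) : A.IsAcyclic := by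
  intro i a ha hda
  refine ⟨h * a, ?_, ?_⟩
  · have := SetLike.mul_mem_graded hh ha
    rwa [neg_add_eq_sub] at this
  · rw [A.leibniz a hh, hd, hda, one_mul, mul_zero, smul_zero, add_zero]

variable (A : CurvedAlgebra k)

/-- The element `x_w`, as an element of `A ⊗ End(k ⊕ k[1])`. -/
def twistingElement : A.matrixAlgebra shiftDegrees :=
  A.endTmul shiftDegrees A.curv !![0, 0; 1, 0] - A.endTmul shiftDegrees 1 !![0, 1; 0, 0]

theorem twistingElement_mem : A.twistingElement ∈ (A.matrixAlgebra shiftDegrees).deg 1 :=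
  A.uncurvingElement_mem

theorem toMatrix_twistingElement :
    A.toMatrix shiftDegrees A.twistingElement = !![0, -1; A.curv, 0] := by
  ext i j
  rw [twistingElement, map_sub, Matrix.sub_apply, toMatrix_endTmul, toMatrix_endTmul,
    A.sign_of_mem_even _ even_two A.curv_mem, sign_one]
  fin_cases i <;> fin_cases j <;> simp

/-- As a matrix, `x_w² = -w · 1`, and `d x_w = 0` because `d w = 0` and `d 1 = 0`. The curvature of
the twist is therefore `w + 0 - w`. -/
theorem isDG_uncurving : A.uncurving.IsDG := by
  change (A.matrixAlgebra shiftDegrees).curv +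
    (A.matrixAlgebra shiftDegrees).d A.twistingElement +
      A.twistingElement * A.twistingElement = 0
  apply (A.toMatrix shiftDegrees).injective
  rw [map_add, map_add, map_mul, map_zero, toMatrix_curv]
  ext i j
  rw [Matrix.add_apply, Matrix.add_apply, toMatrix_d, toMatrix_twistingElement]
  fin_cases i <;> fin_cases j <;> simp [A.d_curv, A.d_one]

/-- For `h` minus the lower left matrix unit, `x_w h` and `h x_w` are the two diagonal idempotents.
As `h` is odd, its graded commutator with `x_w` is their sum `1`, and `d h = 0` before twisting. -/
theorem isAcyclic_uncurving : A.uncurving.IsAcyclic := by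
  let h : A.matrixAlgebra shiftDegrees := A.endTmul shiftDegrees (-1) !![0, 0; 1, 0]
  have hE : (!![0, 0; 1, 0] : Matrix (Fin 2) (Fin 2) k) ∈ endDeg shiftDegrees k (-1) := by
    intro i j h
    fin_cases i <;> fin_cases j <;> simp [shiftDegrees] at h ⊢
  have hh : h ∈ (A.matrixAlgebra shiftDegrees).deg (-1) := by
    have := A.endTmul_mem shiftDegrees (neg_mem SetLike.GradedOne.one_mem) hE
    rwa [zero_add] at this
  have hm : A.toMatrix shiftDegrees h = !![0, 0; -1, 0] := by
    ext i j
    rw [toMatrix_endTmul, map_neg, sign_one]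
    fin_cases i <;> fin_cases j <;> simp
  refine isAcyclic_of_d_eq_one A.uncurving (h := h) hh ?_
  change (A.matrixAlgebra shiftDegrees).d h +
    (A.matrixAlgebra shiftDegrees).oddCommutator A.twistingElement h = 1
  rw [oddCommutator_of_mem _ _ hh, Int.negOnePow_odd _ (by decide), Units.neg_smul, one_smul,
    sub_neg_eq_add]
  apply (A.toMatrix shiftDegrees).injective
  rw [map_add, map_add, map_mul, map_mul, map_one, toMatrix_twistingElement]
  ext i j
  rw [Matrix.add_apply, toMatrix_d, hm]
  fin_cases i <;> fin_cases j <;> simp [A.d_one]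

end CurvedAlgebra

/-! ### Gradings from projections, and twisting of curved modules. -/

theorem isInternal_of_projections {R M ι : Type*} [Ring R] [AddCommGroup M] [Module R M]
    [DecidableEq ι] (deg : ι → Submodule R M) (π : ι → M →ₗ[R] M)
    (h1 : ∀ i, ∀ m ∈ deg i, π i m = m) (h2 : ∀ i j, i ≠ j → ∀ m ∈ deg j, π i m = 0)
    (h3 : ∀ m, m ∈ ⨆ i, deg i) : DirectSum.IsInternal deg := by
  refine DirectSum.isInternal_submodule_of_iSupIndep_of_iSup_eq_top ?_
    (Submodule.eq_top_iff'.2 h3)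
  rw [iSupIndep_def]
  intro i
  rw [Submodule.disjoint_def]
  intro m hm hm'
  -- Independence: `π i` kills every other component but is the identity on `deg i`, so the
  -- intersection is zero.
  have hle : ⨆ j, ⨆ (_ : j ≠ i), deg j ≤ LinearMap.ker (π i) :=
    iSup₂_le fun j hj m hm => h2 i j hj.symm m hm
  rw [← h1 i m hm]
  exact hle hm'

namespace CurvedModule

open MulOpposite

variable {k : Type u} [Field k] {A : CurvedAlgebra k}

/-- Induction on sums of homogeneous elements. -/
theorem hom_induction (M : CurvedModule A) {P : M → Prop} (h0 : P 0)
    (hom : ∀ (i : ℤ) (m : M), m ∈ M.deg i → P m) (add : ∀ m n, P m → P n → P (m + n)) (m : M) :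
    P m :=
  DirectSum.Decomposition.inductionOn M.deg h0 (fun m => hom _ m m.2) add m

/-- The projection of a graded module to its component of degree `n`. -/
def proj (M : CurvedModule A) (n : ℤ) : M →ₗ[k] M :=
  (M.deg n).subtype ∘ₗ DirectSum.component k ℤ (fun i => M.deg i) n ∘ₗ
    (DirectSum.decomposeLinearEquiv M.deg).toLinearMap

theorem proj_of_mem (M : CurvedModule A) {n : ℤ} {m : M} (hm : m ∈ M.deg n) : M.proj n m = m :=
  DirectSum.decompose_of_mem_same M.deg hm

theorem proj_of_mem_ne (M : CurvedModule A) {n i : ℤ} {m : M} (hm : m ∈ M.deg i) (h : i ≠ n) :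
    M.proj n m = 0 :=
  DirectSum.decompose_of_mem_ne M.deg hm h

/-- The parity involution `m ↦ (-1)^|m| m`. -/
def parity (M : CurvedModule A) : M →ₗ[k] M :=
  (DirectSum.toModule k ℤ M fun i => i.negOnePow • (M.deg i).subtype) ∘ₗ
    (DirectSum.decomposeLinearEquiv M.deg).toLinearMap

theorem parity_of_mem (M : CurvedModule A) {i : ℤ} {m : M} (hm : m ∈ M.deg i) :
    M.parity m = i.negOnePow • m := by
  lift m to M.deg i using hm
  simp [parity]

/-- The right action of an element of `A`, as a linear map. -/
def act (M : CurvedModule A) (a : A) : M →ₗ[k] M where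
  toFun m := op a • m
  map_add' := smul_add _
  map_smul' c m := smul_comm (op a) c m

section Twist

variable (x : A) (hx : x ∈ A.deg 1)

/-- The differential `m ↦ d m - (-1)^|m| m x`. -/
def twistD (M : CurvedModule A) : M →ₗ[k] M := M.d - M.act x ∘ₗ M.parity

theorem twistD_of_mem (M : CurvedModule A) {i : ℤ} {m : M} (hm : m ∈ M.deg i) :
    M.twistD x m = M.d m - i.negOnePow • op x • m := by
  change M.d m - M.act x (M.parity m) = _
  rw [M.parity_of_mem hm, LinearMap.map_smul_of_tower]
  rfl

/-- The curved module over `A^x` obtained from a curved module over `A`. -/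
def twist (M : CurvedModule A) : CurvedModule (A.twist x hx) where
  carrier := M
  rightModule := M.rightModule
  isScalarTower := M.isScalarTower
  deg := M.deg
  smul_mem := M.smul_mem
  d := M.twistD x
  d_mem := by
    intro i m hm
    rw [M.twistD_of_mem x hm]
    exact sub_mem (M.d_mem hm) ((M.deg _).smul_of_tower_mem _ (M.smul_mem hm hx))
  leibniz := by
    intro i m a hm
    change M.twistD x (op (show A from a) • m) = op (show A from a) • M.twistD x m +
      i.negOnePow • op (A.d a + A.oddCommutator x a) • m
    induction a using A.hom_induction with
    | h0 => simp
    | add a b ha hb =>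
      simp only [map_add, op_add, add_smul, smul_add] at ha hb ⊢
      rw [ha, hb]
      abel
    | hom j a ha =>
      rw [M.twistD_of_mem x hm, M.twistD_of_mem x (M.smul_mem hm ha), M.leibniz a hm,
        A.oddCommutator_of_mem x ha]
      -- All signs depend only on the parities of `i` and `j`, and each case is an additive
      -- identity.
      rcases Int.even_or_odd i with h1 | h1 <;> rcases Int.even_or_odd j with h2 | h2 <;>
        simp [Int.negOnePow_add, Int.negOnePow_even, Int.negOnePow_odd, h1, h2, add_smul, sub_smul,
          smul_sub, mul_smul] <;> abel
  d_d := by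
    intro m
    change M.twistD x (M.twistD x m) = -(op (A.curv + A.d x + x * x) • m)
    induction m using M.hom_induction with
    | h0 => simp
    | add m n hm hn => rw [map_add, map_add, hm, hn, smul_add, neg_add]
    | hom i m hm =>
      -- The two terms in `(d m) x` cancel; what remains is `-m w - m (d x) - m x²`, minus the
      -- action of the twisted curvature.
      rw [M.twistD_of_mem x hm, map_sub, LinearMap.map_smul_of_tower,
        M.twistD_of_mem x (M.d_mem hm), M.twistD_of_mem x (M.smul_mem hm hx), M.leibniz x hm, M.d_d]
      rcases Int.even_or_odd i with h1 | h1 <;>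
        simp [Int.negOnePow_even, Int.negOnePow_odd, h1, add_smul, mul_smul] <;> abel

/-- The differential `m ↦ d m + (-1)^|m| m x` of a curved module over `A^x`. -/
def untwistD (M : CurvedModule (A.twist x hx)) : M →ₗ[k] M := M.d + M.act x ∘ₗ M.parity

/-- The right `A`-module structure of a curved module over `A^x`. -/
abbrev untwistModule (M : CurvedModule (A.twist x hx)) : Module (A.carrier)ᵐᵒᵖ M := M.rightModule

theorem untwistD_of_mem (M : CurvedModule (A.twist x hx)) {i : ℤ} {m : M} (hm : m ∈ M.deg i) :
    letI := M.untwistModule x hx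
    M.untwistD x hx m = M.d m + i.negOnePow • op x • m := by
  change M.d m + M.act x (M.parity m) = _
  rw [M.parity_of_mem hm, LinearMap.map_smul_of_tower]
  rfl

/-- The curved module over `A` obtained from a curved module over `A^x`. -/
def untwist (M : CurvedModule (A.twist x hx)) : CurvedModule A where
  carrier := M
  rightModule := M.rightModule
  isScalarTower := M.isScalarTower
  deg := M.deg
  smul_mem := M.smul_mem
  d := M.untwistD x hx
  d_mem := by
    intro i m hm
    rw [M.untwistD_of_mem x hx hm]
    exact add_mem (M.d_mem hm) ((M.deg _).smul_of_tower_mem _ (M.smul_mem hm hx))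
  leibniz := by
    let _ := M.untwistModule x hx
    intro i m a hm
    change M.untwistD x hx (op a • m) = op a • M.untwistD x hx m + i.negOnePow • op (A.d a) • m
    induction a using A.hom_induction with
    | h0 => simp
    | add a b ha hb =>
      simp only [map_add, op_add, add_smul, smul_add] at ha hb ⊢
      rw [ha, hb]
      abel
    | hom j a ha =>
      have h : M.d (op a • m) = op a • M.d m + i.negOnePow • op (A.d a + A.oddCommutator x a) • m :=
        M.leibniz a hm
      have hma : op a • m ∈ M.deg (i + j) := M.smul_mem hm ha
      rw [M.untwistD_of_mem x hx hm, M.untwistD_of_mem x hx hma, h,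
        A.oddCommutator_of_mem x ha]
      rcases Int.even_or_odd i with h1 | h1 <;> rcases Int.even_or_odd j with h2 | h2 <;>
        simp [Int.negOnePow_add, Int.negOnePow_even, Int.negOnePow_odd, h1, h2, add_smul, sub_smul,
          mul_smul] <;> abel
  d_d := by
    let _ := M.untwistModule x hx
    intro m
    change M.untwistD x hx (M.untwistD x hx m) = -(op A.curv • m)
    induction m using M.hom_induction with
    | h0 => simp
    | add m n hm hn => rw [map_add, map_add, hm, hn, smul_add, neg_add]
    | hom i m hm =>
      have h : M.d (op x • m) = op x • M.d m + i.negOnePow • op (A.d x + A.oddCommutator x x) • m :=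
        M.leibniz x hm
      have hd : M.d (M.d m) = -(op (A.curv + A.d x + x * x) • m) := M.d_d m
      have hmx : op x • m ∈ M.deg (i + 1) := M.smul_mem hm hx
      rw [M.untwistD_of_mem x hx hm, map_add, LinearMap.map_smul_of_tower,
        M.untwistD_of_mem x hx (M.d_mem hm), M.untwistD_of_mem x hx hmx, h, hd, A.oddCommutator_of_mem x hx]
      rcases Int.even_or_odd i with h1 | h1 <;>
        simp [Int.negOnePow_even, Int.negOnePow_odd, h1, add_smul, mul_smul] <;>
        abel

/-- Only the differential changes, by opposite terms. Since `untwist` lands in modules over `A`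
itself rather than over a double twist, this is an equality of modules and not merely an
isomorphism. -/
theorem twist_untwist (M : CurvedModule (A.twist x hx)) : (M.untwist x hx).twist x hx = M := by
  cases M
  simp only [twist, untwist]
  congr 1
  exact add_sub_cancel_right _ _

/-- Being finitely generated twisted does not involve the differential, and `A` and `A^x` have the
same underlying graded algebra. -/
theorem isFGTwisted_twist {M : CurvedModule A} : (M.twist x hx).IsFGTwisted ↔ M.IsFGTwisted :=
  Iff.rfl

theorem isFGTwisted_untwist {M : CurvedModule (A.twist x hx)} : (M.untwist x hx).IsFGTwisted ↔ M.IsFGTwisted :=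
  Iff.rfl

end Twist

end CurvedModule

/-! ### The functor `M ↦ M ⊗ V*` and the twist functor. -/

namespace CurvedModule

open MulOpposite DGCategory

variable {k : Type u} [Field k] {A : CurvedAlgebra k} {ι : Type} (p : ι → ℤ)

section Shifts

/-- The grading of `⨁ i, M[p i]`. -/
def piDeg (M : CurvedModule A) (p : ι → ℤ) (n : ℤ) : Submodule k (ι → M) :=
  Submodule.pi Set.univ fun i => M.deg (n + p i)

theorem mem_piDeg {M : CurvedModule A} {n : ℤ} {m : ι → M} :
    m ∈ piDeg M p n ↔ ∀ i, m i ∈ M.deg (n + p i) := by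
  simp [piDeg]

theorem single_mem_piDeg [DecidableEq ι] {M : CurvedModule A} {n : ℤ} {i : ι} {m : M}
    (hm : m ∈ M.deg (n + p i)) : Pi.single i m ∈ piDeg M p n := by
  rw [mem_piDeg]
  intro j
  by_cases h : j = i
  · subst h; rwa [Pi.single_eq_same]
  · rw [Pi.single_eq_of_ne h]; exact zero_mem _

theorem isInternal_piDeg [Fintype ι] (M : CurvedModule A) : DirectSum.IsInternal (piDeg M p) := by
  classical
  refine isInternal_of_projections _
    (fun n => LinearMap.pi fun i => M.proj (n + p i) ∘ₗ LinearMap.proj i) ?_ ?_ ?_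
  · intro n m hm
    funext i
    exact M.proj_of_mem ((mem_piDeg p).1 hm i)
  · intro n l hnl m hm
    funext i
    exact M.proj_of_mem_ne ((mem_piDeg p).1 hm i) (by omega)
  · intro m
    rw [← Finset.univ_sum_single m]
    refine sum_mem fun i _ => ?_
    induction m i using M.hom_induction with
    | h0 => rw [Pi.single_zero]; exact zero_mem _
    | add m n hm hn => rw [Pi.single_add]; exact add_mem hm hn
    | hom n m hm =>
      -- Slot `i` is shifted by `p i`, so an entry of degree `n` there gives a vector of degree `n -
      -- p i`.
      exact Submodule.mem_iSup_of_mem (n - p i) (single_mem_piDeg p (by rwa [sub_add_cancel]))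

end Shifts

variable [Fintype ι] [DecidableEq ι]

/-- The right action of `A ⊗ End(V)` on row vectors with entries in `M`. -/
abbrev rowAction (M : CurvedModule A) : Module (A.matrixAlgebra p).carrierᵐᵒᵖ (ι → M) where
  smul b m := fun l => ∑ j, op (A.toMatrix p b.unop j l) • m j
  one_smul m := by
    funext l
    change ∑ j, op (A.toMatrix p 1 j l) • m j = m l
    rw [map_one, Finset.sum_eq_single l]
    · rw [Matrix.one_apply_eq, op_one, one_smul]
    · intro j _ hj
      rw [Matrix.one_apply_ne hj, op_zero, zero_smul]
    · simp
  mul_smul b c m := by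
    funext l
    change ∑ j, op (A.toMatrix p (c.unop * b.unop) j l) • m j =
      ∑ i, op (A.toMatrix p b.unop i l) • ∑ j, op (A.toMatrix p c.unop j i) • m j
    simp only [map_mul, Matrix.mul_apply, Finset.smul_sum, Finset.op_sum, op_mul, Finset.sum_smul,
      mul_smul]
    exact Finset.sum_comm
  smul_zero b := by
    funext l
    change ∑ j, op (A.toMatrix p b.unop j l) • (0 : M) = 0
    simp
  smul_add b m n := by
    funext l
    change ∑ j, op (A.toMatrix p b.unop j l) • (m j + n j) =
      (∑ j, op (A.toMatrix p b.unop j l) • m j) + ∑ j, op (A.toMatrix p b.unop j l) • n j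
    simp [Finset.sum_add_distrib]
  add_smul b c m := by
    funext l
    change ∑ j, op (A.toMatrix p (b.unop + c.unop) j l) • m j =
      (∑ j, op (A.toMatrix p b.unop j l) • m j) + ∑ j, op (A.toMatrix p c.unop j l) • m j
    simp [Finset.sum_add_distrib, add_smul]
  zero_smul m := by
    funext l
    change ∑ j, op (A.toMatrix p 0 j l) • m j = 0
    simp

/-- The curved module `M ⊗ V*` over `A ⊗ End(V)`, of row vectors with entries in `M`. -/
def row (M : CurvedModule A) : CurvedModule (A.matrixAlgebra p) where
  carrier := ι → M
  rightModule := M.rowAction p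
  isScalarTower := by
    let _ := M.rowAction p
    refine ⟨fun c b m => ?_⟩
    funext l
    change ∑ j, op (A.toMatrix p (c • b.unop) j l) • m j =
      c • ∑ j, op (A.toMatrix p b.unop j l) • m j
    simp [Finset.smul_sum]
  deg := piDeg M p
  decomposition := (isInternal_piDeg p M).chooseDecomposition
  smul_mem := by
    intro i n m b hm hb
    rw [mem_piDeg] at hm ⊢
    rw [CurvedAlgebra.mem_deg_iff_toMatrix] at hb
    refine fun l => sum_mem fun j _ => ?_
    have := M.smul_mem (hm j) (hb j l)
    rwa [show i + p j + (n - p j + p l) = i + n + p l by ring] at this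
  d := M.d.compLeft ι
  d_mem := by
    intro i m hm
    rw [mem_piDeg] at hm ⊢
    intro l
    have := M.d_mem (hm l)
    rwa [add_right_comm] at this
  leibniz := by
    intro n m b hm
    rw [mem_piDeg] at hm
    funext l
    change M.d (∑ j, op (A.toMatrix p b j l) • m j) = ∑ j, op (A.toMatrix p b j l) • M.d (m j) +
      n.negOnePow • ∑ j, op (A.toMatrix p ((A.matrixAlgebra p).d b) j l) • m j
    rw [map_sum, Finset.smul_sum, ← Finset.sum_add_distrib]
    refine Finset.sum_congr rfl fun j _ => ?_
    -- The entry `m j` has degree `n + p j`; the extra `(-1)^(p j)` is exactly the row sign in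
    -- `toMatrix_d`. Hence `d` acts on rows entrywise without signs.
    rw [M.leibniz _ (hm j), CurvedAlgebra.toMatrix_d, Int.negOnePow_add]
    congr 1
    rcases Int.units_eq_one_or (p j).negOnePow with h | h <;> simp [h]
  d_d := by
    intro m
    funext l
    change M.d (M.d (m l)) =
      -∑ j, op (A.toMatrix p (A.matrixAlgebra p).curv j l) • m j
    rw [M.d_d, A.toMatrix_curv, Finset.sum_eq_single l]
    · simp
    · intro j _ hj
      simp [hj]
    · simp

theorem row_smul (M : CurvedModule A) (b : A.matrixAlgebra p) (m : row p M) (l : ι) :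
    (op b • m : row p M) l = ∑ j, op (A.toMatrix p b j l) • (m : ι → M) j := rfl

theorem mem_row_deg {M : CurvedModule A} {n : ℤ} {m : row p M} :
    m ∈ (row p M).deg n ↔ ∀ i, (m : ι → M) i ∈ M.deg (n + p i) :=
  mem_piDeg p (m := (m : ι → M))

/-- The row vector with a single nonzero entry. -/
def rowSingle (M : CurvedModule A) (i : ι) : M →ₗ[k] row p M :=
  LinearMap.single k (fun _ => M) i

theorem rowSingle_apply {M : CurvedModule A} (i l : ι) (m : M) :
    (rowSingle p M i m : ι → M) l = if l = i then m else 0 :=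
  Pi.single_apply i m l

theorem rowSingle_mem {M : CurvedModule A} {n : ℤ} {i : ι} {m : M} (hm : m ∈ M.deg (n + p i)) :
    rowSingle p M i m ∈ (row p M).deg n :=
  single_mem_piDeg p hm

theorem sum_rowSingle {M : CurvedModule A} (m : row p M) :
    ∑ i, rowSingle p M i ((m : ι → M) i) = m :=
  Finset.univ_sum_single (m : ι → M)

/-- The action of `M ↦ M ⊗ V*` on morphisms. -/
def rowMap {M N : CurvedModule A} (n : ℤ) : homDeg M N n →ₗ[k] homDeg (row p M) (row p N) n where
  toFun f := ⟨{ toFun := fun (m : ι → M) i => f.1 (m i)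
                map_add' := fun m m' => funext fun i => map_add f.1 _ _
                map_smul' := fun b m => funext fun l => by
                  change f.1 (∑ j, op (A.toMatrix p b.unop j l) • m j) =
                    ∑ j, op (A.toMatrix p b.unop j l) • f.1 (m j)
                  simp }, by
      intro i m hm
      refine (mem_row_deg p).2 fun l => ?_
      have := f.2 _ _ ((mem_row_deg p).1 hm l)
      rwa [add_right_comm] at this⟩
  map_add' _ _ := rfl
  map_smul' _ _ := rfl

theorem rowMap_injective [Nonempty ι] {M N : CurvedModule A} (n : ℤ) :
    Function.Injective (rowMap p (M := M) (N := N) n) := by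
  intro f g h
  refine homDeg_ext fun m => ?_
  have i : ι := Classical.arbitrary ι
  exact congrFun (congrArg (fun e : homDeg (row p M) (row p N) n =>
    (e.1 (fun _ => m : ι → M) : ι → N)) h) i

/-- The element of `A ⊗ End(V)` corresponding to the matrix with one nonzero entry. -/
def unit (i j : ι) (a : A) : A.matrixAlgebra p := (A.toMatrix p).symm (Matrix.single i j a)

theorem unit_smul {M : CurvedModule A} (i j : ι) (a : A) (m : row p M) :
    op (unit p i j a) • m = rowSingle p M j (op a • (m : ι → M) i) := by
  funext l
  rw [row_smul, unit, AlgEquiv.apply_symm_apply, rowSingle_apply, Finset.sum_eq_single i]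
  · by_cases h : l = j
    · subst h; simp
    · simp [h, Ne.symm h]
  · intro r _ hr
    simp [hr.symm]
  · simp

theorem unit_smul_rowSingle {M : CurvedModule A} (i j : ι) (a : A) (m : M) :
    op (unit p i j a) • rowSingle p M i m = rowSingle p M j (op a • m) := by
  rw [unit_smul, rowSingle_apply, if_pos rfl]

/-- A map commuting with all matrix units is determined by one entry. Here `f` is read off at slot
`i₀`, and the units from `i₀` to `i` force `g` to be `f` in every slot. -/
theorem rowMap_surjective [Nonempty ι] {M N : CurvedModule A} (n : ℤ) :
    Function.Surjective (rowMap p (M := M) (N := N) n) := by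
  intro g
  have i₀ : ι := Classical.arbitrary ι
  let f : M → N := fun m => (g.1 (rowSingle p M i₀ m) : ι → N) i₀
  have key : ∀ (i : ι) (a : A) (m : M),
      g.1 (rowSingle p M i (op a • m)) = rowSingle p N i (op a • f m) := by
    intro i a m
    rw [← unit_smul_rowSingle p i₀, map_smul, unit_smul]
  have key' : ∀ (i : ι) (m : M), g.1 (rowSingle p M i m) = rowSingle p N i (f m) := by
    intro i m
    simpa using key i 1 m
  refine ⟨⟨{ toFun := f
             map_add' := fun m m' => ?_
             map_smul' := fun a m => ?_ }, ?_⟩, ?_⟩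
  · change (g.1 (rowSingle p M i₀ (m + m')) : ι → N) i₀ = _
    rw [map_add, map_add]
    rfl
  · change (g.1 (rowSingle p M i₀ (a • m)) : ι → N) i₀ = a • f m
    rw [← op_unop a, key, rowSingle_apply, if_pos rfl]
  · intro i m hm
    have h := g.2 (i - p i₀) _ (rowSingle_mem p (i := i₀) (by rwa [sub_add_cancel]))
    have h' := (mem_row_deg p).1 h i₀
    rwa [show i - p i₀ + n + p i₀ = i + n by ring] at h'
  · refine homDeg_ext fun m => ?_
    conv_rhs => rw [← sum_rowSingle p m, map_sum]
    simp only [key']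
    exact (sum_rowSingle p (M := N) _).symm

/-- The dg functor `M ↦ M ⊗ V*`. -/
def rowFunctor : DGFunctor k (CurvedModule A) (CurvedModule (A.matrixAlgebra p)) where
  obj := row p
  map n := rowMap p n
  map_d _ _ _ _ := rfl
  map_id _ := rfl
  map_comp _ _ _ := rfl

theorem rowFunctor_fullyFaithful [Nonempty ι] :
    (rowFunctor p (A := A)).FullyFaithful :=
  fun _ _ n => ⟨rowMap_injective p n, rowMap_surjective p n⟩

theorem rowMap_surjective_iff [Nonempty ι] {M N : CurvedModule A} (f : homDeg M N 0) :
    Function.Surjective (rowMap p 0 f).1 ↔ Function.Surjective f.1 := by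
  constructor
  · intro h n
    have i : ι := Classical.arbitrary ι
    obtain ⟨m, hm⟩ := h (fun _ => n : ι → N)
    exact ⟨(m : ι → M) i, congrFun hm i⟩
  · intro h n
    choose g hg using h
    exact ⟨(fun i => g ((n : ι → N) i) : ι → M), funext fun i => hg _⟩

section Twist

variable (x : A) (hx : x ∈ A.deg 1)

/-- The dg functor from curved modules over `A` to curved modules over `A^x`. -/
def twistFunctor : DGFunctor k (CurvedModule A) (CurvedModule (A.twist x hx)) where
  obj M := M.twist x hx
  map {M N} n := (LinearMap.id : homDeg M N n →ₗ[k] homDeg M N n)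
  map_d := by
    rintro M N n l h f
    refine homDeg_ext fun (m : M) => ?_
    change N.d (f.1 m) - n.negOnePow • f.1 (M.d m) =
      N.twistD x (f.1 m) - n.negOnePow • f.1 (M.twistD x m)
    induction m using M.hom_induction with
    | h0 => simp
    | add m m' h h' =>
      simp only [map_add, smul_add]
      rw [add_sub_add_comm, h, h', add_sub_add_comm]
    | hom i m hm =>
      -- The correction terms are `(-1)^(i+n) f(m) x` and `(-1)^n (-1)^i f(m x)`; they cancel by
      -- linearity of `f`, so twisting leaves the differential on morphisms unchanged.
      rw [N.twistD_of_mem x (f.2 i m hm), M.twistD_of_mem x hm, map_sub,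
        LinearMap.map_smul_of_tower, map_smul, Int.negOnePow_add]
      simp only [smul_sub, smul_smul, mul_comm]
      abel
  map_id _ := rfl
  map_comp _ _ _ := rfl

theorem twistFunctor_fullyFaithful : (twistFunctor x hx).FullyFaithful :=
  fun _ _ _ => Function.bijective_id

end Twist

end CurvedModule

/-! ### Composition of dg functors. -/

/-- The composite of two dg functors. -/
def DGFunctor.comp {k : Type u} [Field k] {C D E : Type*} [DGCategory.{u} k C]
    [DGCategory.{u} k D] [DGCategory.{u} k E] (G : DGFunctor k D E) (F : DGFunctor k C D) :
    DGFunctor k C E where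
  obj X := G.obj (F.obj X)
  map n := G.map n ∘ₗ F.map n
  map_d i j h f := by simp only [LinearMap.comp_apply, F.map_d, G.map_d]
  map_id X := by simp only [LinearMap.comp_apply, F.map_id, G.map_id]
  map_comp h g f := by simp only [LinearMap.comp_apply, F.map_comp, G.map_comp]

theorem DGFunctor.FullyFaithful.comp {k : Type u} [Field k] {C D E : Type*} [DGCategory.{u} k C]
    [DGCategory.{u} k D] [DGCategory.{u} k E] {G : DGFunctor k D E} {F : DGFunctor k C D}
    (hG : G.FullyFaithful) (hF : F.FullyFaithful) : (G.comp F).FullyFaithful :=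
  fun _ _ n => (hG _ _ n).comp (hF _ _ n)

theorem DGFunctor.map_closedIso {k : Type u} [Field k] {C D : Type*} [DGCategory.{u} k C]
    [DGCategory.{u} k D] (F : DGFunctor k C D) {X Y : C} (h : DGCategory.ClosedIso k X Y) :
    DGCategory.ClosedIso k (F.obj X) (F.obj Y) := by
  obtain ⟨f, g, hf, hg, h1, h2⟩ := h
  exact ⟨F.map 0 f, F.map 0 g, F.map_closed hf, F.map_closed hg,
    by rw [← F.map_comp, h1, F.map_id], by rw [← F.map_comp, h2, F.map_id]⟩

/-! ### Matrix units and the inverse construction `N ↦ N e`. -/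

namespace CurvedModule

open MulOpposite DGCategory

variable {k : Type u} [Field k] {A : CurvedAlgebra k} {ι : Type} [Fintype ι] [DecidableEq ι]
  (p : ι → ℤ)

theorem unit_add (i j : ι) (a b : A) : unit p i j (a + b) = unit p i j a + unit p i j b := by
  simp [unit, Matrix.single_add]

theorem unit_zero (i j : ι) : unit p i j (0 : A) = 0 := by
  simp [unit]

theorem unit_const_smul (i j : ι) (c : k) (a : A) : unit p i j (c • a) = c • unit p i j a := by
  rw [unit, ← Matrix.smul_single, map_smul, unit]

theorem unit_mul_unit (i j l : ι) (a b : A) :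
    unit p i j a * unit p j l b = unit p i l (a * b) := by
  rw [unit, unit, ← map_mul, Matrix.single_mul_single_same, unit]

theorem unit_mul_unit_of_ne (i l : ι) {j r : ι} (h : j ≠ r) (a b : A) :
    unit p i j a * unit p r l b = 0 := by
  rw [unit, unit, ← map_mul, Matrix.single_mul_single_of_ne _ _ _ _ h, map_zero]

theorem unit_mem {i j : ι} {n l : ℤ} {a : A} (ha : a ∈ A.deg n) (h : n + p i - p j = l) :
    unit p i j a ∈ (A.matrixAlgebra p).deg l := by
  rw [CurvedAlgebra.mem_deg_iff_toMatrix, unit, AlgEquiv.apply_symm_apply]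
  intro r s
  by_cases hrs : i = r ∧ j = s
  · obtain ⟨rfl, rfl⟩ := hrs
    rw [Matrix.single_apply_same]
    rwa [← h, show n + p i - p j - p i + p j = n by ring]
  · rw [Matrix.single_apply_of_ne _ _ _ _ _ hrs]
    exact zero_mem _

/-- The sign comes from the row `i` alone. It disappears in a row with `p i = 0`, which is why the
corner is taken at a basis vector of degree `0`. -/
theorem d_unit (i j : ι) (a : A) :
    (A.matrixAlgebra p).d (unit p i j a) = (p i).negOnePow • unit p i j (A.d a) := by
  apply (A.toMatrix p).injective
  ext r s
  rw [CurvedAlgebra.toMatrix_d]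
  have h : A.toMatrix p ((p i).negOnePow • unit p i j (A.d a)) =
      (p i).negOnePow • A.toMatrix p (unit p i j (A.d a)) :=
    LinearMap.map_smul_of_tower (A.toMatrix p).toLinearMap _ _
  rw [h, Matrix.smul_apply]
  rw [unit, unit, AlgEquiv.apply_symm_apply, AlgEquiv.apply_symm_apply, Matrix.single_apply,
    Matrix.single_apply]
  split_ifs with hij
  · rw [hij.1]
  · simp

theorem sum_unit (b : A.matrixAlgebra p) : ∑ i, ∑ j, unit p i j (A.toMatrix p b i j) = b := by
  apply (A.toMatrix p).injective
  conv_rhs => rw [Matrix.matrix_eq_sum_single (A.toMatrix p b)]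
  simp [unit]

theorem sum_unit_one : ∑ i, unit p i i (1 : A) = 1 := by
  apply (A.toMatrix p).injective
  rw [map_one, map_sum]
  ext r s
  rw [Matrix.sum_apply, Finset.sum_eq_single r]
  · rw [unit, AlgEquiv.apply_symm_apply, Matrix.single_apply, Matrix.one_apply]
    simp
  · intro i _ hi
    rw [unit, AlgEquiv.apply_symm_apply, Matrix.single_apply]
    simp [hi]
  · simp

theorem unit_mul (b : A.matrixAlgebra p) (i j : ι) (a : A) :
    unit p i j a * b = ∑ l, unit p i l (a * A.toMatrix p b j l) := by
  conv_lhs => rw [← sum_unit p b, Finset.mul_sum]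
  rw [Finset.sum_eq_single j]
  · rw [Finset.mul_sum]
    exact Finset.sum_congr rfl fun l _ => unit_mul_unit p i j l _ _
  · intro r _ hr
    rw [Finset.mul_sum]
    exact Finset.sum_eq_zero fun l _ => unit_mul_unit_of_ne p i l hr.symm _ _
  · simp

theorem unit_mul_curv (i j : ι) (a : A) :
    unit p i j a * (A.matrixAlgebra p).curv = unit p i j (a * A.curv) := by
  apply (A.toMatrix p).injective
  rw [map_mul, A.toMatrix_curv, unit, unit, AlgEquiv.apply_symm_apply, AlgEquiv.apply_symm_apply]
  ext r s
  rw [Matrix.scalar_apply, Matrix.mul_diagonal, Matrix.single_apply, Matrix.single_apply, ite_mul,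
    zero_mul]

variable {p} (i₀ : ι)

/-- The image of the idempotent matrix unit `e` in a curved module over `A ⊗ End(V)`. -/
def cornerSubmodule (N : CurvedModule (A.matrixAlgebra p)) : Submodule k N :=
  LinearMap.eqLocus (N.act (unit p i₀ i₀ 1)) LinearMap.id

theorem mem_corner {N : CurvedModule (A.matrixAlgebra p)} {n : N} :
    n ∈ N.cornerSubmodule i₀ ↔ op (unit p i₀ i₀ (1 : A)) • n = n :=
  Iff.rfl

theorem unit_smul_mem_corner {N : CurvedModule (A.matrixAlgebra p)} (i : ι) (a : A) (n : N) :
    op (unit p i i₀ a) • n ∈ N.cornerSubmodule i₀ := by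
  rw [mem_corner, ← mul_smul, ← op_mul, unit_mul_unit, mul_one]

/-- The right action of `A` on the image of a matrix unit. -/
abbrev cornerAction (N : CurvedModule (A.matrixAlgebra p)) :
    Module (A.carrier)ᵐᵒᵖ (N.cornerSubmodule i₀) where
  smul a n := ⟨op (unit p i₀ i₀ a.unop) • (n : N), unit_smul_mem_corner i₀ i₀ _ _⟩
  one_smul n := Subtype.ext n.2
  mul_smul a b n := Subtype.ext <| by
    change op (unit p i₀ i₀ (b.unop * a.unop)) • (n : N) =
      op (unit p i₀ i₀ a.unop) • op (unit p i₀ i₀ b.unop) • (n : N)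
    rw [← mul_smul, ← op_mul, unit_mul_unit]
  smul_zero a := Subtype.ext (smul_zero (op (unit p i₀ i₀ a.unop)))
  smul_add a m n := Subtype.ext (smul_add (op (unit p i₀ i₀ a.unop)) (m : N) (n : N))
  add_smul a b n := Subtype.ext <| by
    change op (unit p i₀ i₀ (a.unop + b.unop)) • (n : N) =
      op (unit p i₀ i₀ a.unop) • (n : N) + op (unit p i₀ i₀ b.unop) • (n : N)
    rw [unit_add, op_add, add_smul]
  zero_smul n := Subtype.ext <| by
    change op (unit p i₀ i₀ 0) • (n : N) = 0
    rw [unit_zero, op_zero, zero_smul]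

/-- The idempotent `e` is closed, so `d` commutes with its action. -/
theorem d_mem_corner (N : CurvedModule (A.matrixAlgebra p)) {n : N}
    (hn : n ∈ N.cornerSubmodule i₀) : N.d n ∈ N.cornerSubmodule i₀ := by
  have key : ∀ n : N, N.d (op (unit p i₀ i₀ (1 : A)) • n) = op (unit p i₀ i₀ (1 : A)) • N.d n := by
    intro n
    induction n using N.hom_induction with
    | h0 => simp
    | add m n hm hn => simp only [smul_add, map_add, hm, hn]
    | hom i n hn => rw [N.leibniz _ hn, d_unit, A.d_one, unit_zero]; simp
  rw [mem_corner] at hn ⊢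
  rw [← key, hn]

/-- As `e` has degree `0`, its action commutes with the projections of `N` to its components, so
these restrict to the corner. -/
theorem isInternal_corner (N : CurvedModule (A.matrixAlgebra p)) :
    DirectSum.IsInternal fun n => (N.deg n).comap (N.cornerSubmodule i₀).subtype := by
  have hmem : ∀ {i : ℤ} {n : N}, n ∈ N.deg i → op (unit p i₀ i₀ (1 : A)) • n ∈ N.deg i := by
    intro i n hn
    have := N.smul_mem hn (unit_mem p (i := i₀) (j := i₀) (SetLike.GradedOne.one_mem (A := A.deg))
      (l := 0) (by ring))
    rwa [add_zero] at this
  have hproj : ∀ (i : ℤ), ∀ n ∈ N.cornerSubmodule i₀, N.proj i n ∈ N.cornerSubmodule i₀ := by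
    intro i n hn
    have key : ∀ n : N, N.proj i (op (unit p i₀ i₀ (1 : A)) • n) =
        op (unit p i₀ i₀ (1 : A)) • N.proj i n := by
      intro n
      induction n using N.hom_induction with
      | h0 => simp
      | add m n hm hn => simp only [smul_add, map_add, hm, hn]
      | hom j n hn =>
        by_cases h : j = i
        · subst h
          rw [N.proj_of_mem hn, N.proj_of_mem (hmem hn)]
        · rw [N.proj_of_mem_ne hn h, N.proj_of_mem_ne (hmem hn) h, smul_zero]
    rw [mem_corner] at hn ⊢
    rw [← key, hn]
  refine isInternal_of_projections _ (fun i => (N.proj i).restrict (hproj i)) ?_ ?_ ?_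
  · intro i n hn
    exact Subtype.ext (N.proj_of_mem hn)
  · intro i j h n hn
    exact Subtype.ext (N.proj_of_mem_ne hn h.symm)
  · rintro ⟨n, hn⟩
    -- The homogeneous components of a corner element are not visibly in the corner, so the
    -- induction runs over all `n` and treats `n e`, which equals `n` on the corner.
    have key : ∀ n : N, (⟨op (unit p i₀ i₀ (1 : A)) • n, unit_smul_mem_corner i₀ i₀ 1 n⟩ :
        N.cornerSubmodule i₀) ∈ ⨆ i, (N.deg i).comap (N.cornerSubmodule i₀).subtype := by
      intro n
      induction n using N.hom_induction with
      | h0 =>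
        have : (⟨op (unit p i₀ i₀ (1 : A)) • (0 : N), unit_smul_mem_corner i₀ i₀ 1 0⟩ :
            N.cornerSubmodule i₀) = 0 := Subtype.ext (smul_zero _)
        exact this ▸ zero_mem _
      | add m n hm hn =>
        convert add_mem hm hn
        exact smul_add _ _ _
      | hom j n hn => exact Submodule.mem_iSup_of_mem j (hmem hn)
    convert key n
    exact hn.symm

/-- The curved module `N e` over `A`, where `e` is the matrix unit of a basis vector of degree
`0`, for a curved module `N` over `A ⊗ End(V)`. -/
def corner (h0 : p i₀ = 0) (N : CurvedModule (A.matrixAlgebra p)) : CurvedModule A where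
  carrier := N.cornerSubmodule i₀
  rightModule := N.cornerAction i₀
  isScalarTower := by
    let _ := N.cornerAction i₀
    refine ⟨fun c a n => Subtype.ext ?_⟩
    change op (unit p i₀ i₀ (c • a.unop)) • (n : N) = c • op (unit p i₀ i₀ a.unop) • (n : N)
    rw [unit_const_smul, op_smul, smul_assoc]
  deg n := (N.deg n).comap (N.cornerSubmodule i₀).subtype
  decomposition := (N.isInternal_corner i₀).chooseDecomposition
  smul_mem := by
    intro i j n a hn ha
    exact N.smul_mem hn (unit_mem p ha (by ring))
  d := N.d.restrict fun _ => N.d_mem_corner i₀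
  d_mem := fun hn => N.d_mem hn
  leibniz := by
    intro i n a hn
    refine Subtype.ext ?_
    change N.d (op (unit p i₀ i₀ a) • (n : N)) = op (unit p i₀ i₀ a) • N.d n +
      ((i.negOnePow • (⟨op (unit p i₀ i₀ (A.d a)) • (n : N), unit_smul_mem_corner i₀ i₀ _ _⟩ :
        N.cornerSubmodule i₀) : N.cornerSubmodule i₀) : N)
    have hn' : (n : N) ∈ N.deg i := hn
    rw [N.leibniz _ hn', d_unit, h0, Int.negOnePow_zero, one_smul]
    rcases Int.units_eq_one_or i.negOnePow with h | h <;> simp [h]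
  d_d := by
    intro n
    refine Subtype.ext ?_
    change N.d (N.d n) = -(op (unit p i₀ i₀ A.curv) • (n : N))
    rw [N.d_d]
    -- Writing `n = n e` turns the action of the full curvature into that of `e w`, which is how `w`
    -- acts on the corner.
    conv_lhs => rw [← (mem_corner i₀).1 n.2]
    rw [← mul_smul, ← op_mul, unit_mul_curv, one_mul]

/-- The entries of an element of `(N e) ⊗ V*`. -/
def rowCornerEntry (h0 : p i₀ = 0) (N : CurvedModule (A.matrixAlgebra p)) (j : ι) :
    row p (N.corner i₀ h0) →ₗ[k] N :=
  ((N.cornerSubmodule i₀).subtype ∘ₗ LinearMap.proj j : (ι → N.cornerSubmodule i₀) →ₗ[k] N)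

theorem row_corner_smul (h0 : p i₀ = 0) (N : CurvedModule (A.matrixAlgebra p))
    (b : A.matrixAlgebra p) (m : row p (N.corner i₀ h0)) (l : ι) :
    rowCornerEntry i₀ h0 N l (op b • m) =
      ∑ j, op (unit p i₀ i₀ (A.toMatrix p b j l)) • rowCornerEntry i₀ h0 N j m :=
  AddSubmonoidClass.coe_finsetSum _ _

/-- The morphism from `(N e) ⊗ V*` to `N`. -/
def rowCornerHom (h0 : p i₀ = 0) (N : CurvedModule (A.matrixAlgebra p)) :
    homDeg (row p (N.corner i₀ h0)) N 0 :=
  ⟨{ toFun := fun m => ∑ j, op (unit p i₀ j (1 : A)) • rowCornerEntry i₀ h0 N j m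
     map_add' := fun m m' => by
      rw [← Finset.sum_add_distrib]
      exact Finset.sum_congr rfl fun j _ => by rw [map_add, smul_add]
     map_smul' := fun b m => by
      rw [RingHom.id_apply, ← op_unop b]
      simp only [row_corner_smul, Finset.smul_sum, ← mul_smul, ← op_mul, unit_mul_unit, mul_one]
      simp only [unit_mul, one_mul, Finset.op_sum, Finset.sum_smul]
      exact Finset.sum_comm }, by
    intro i m hm
    refine Submodule.sum_mem _ fun j _ => ?_
    have hj := (mem_row_deg p).1 hm j
    have := N.smul_mem (m := rowCornerEntry i₀ h0 N j m) hj
      (unit_mem p (i := i₀) (j := j) (SetLike.GradedOne.one_mem (A := A.deg)) (l := -p j)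
        (by rw [h0]; ring))
    rwa [show i + p j + -p j = i + 0 by ring] at this⟩

/-- The inverse sends `n` to the row `(n e_{j i₀})_j`. One composite is the identity since the
diagonal units sum to `1`, the other by orthogonality of matrix units; both maps use only closed
units. -/
theorem row_corner_closedIso (h0 : p i₀ = 0) (N : CurvedModule (A.matrixAlgebra p)) :
    ClosedIso k (row p (N.corner i₀ h0)) N := by
  have hd : ∀ (j : ι) (n : N), N.d (op (unit p i₀ j (1 : A)) • n) =
      op (unit p i₀ j (1 : A)) • N.d n := by
    intro j n
    induction n using N.hom_induction with
    | h0 => simp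
    | add m n hm hn => simp only [smul_add, map_add, hm, hn]
    | hom i n hn => rw [N.leibniz _ hn, d_unit, A.d_one, unit_zero]; simp
  refine closedIso_of_inverse (rowCornerHom i₀ h0 N) ?_
    (fun n => (fun j => ⟨op (unit p j i₀ (1 : A)) • n, unit_smul_mem_corner i₀ j 1 n⟩ :
      ι → N.cornerSubmodule i₀)) ?_ ?_ ?_
  · intro m
    change N.d (∑ j, op (unit p i₀ j (1 : A)) • rowCornerEntry i₀ h0 N j m) =
      ∑ j, op (unit p i₀ j (1 : A)) • N.d (rowCornerEntry i₀ h0 N j m)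
    rw [map_sum]
    exact Finset.sum_congr rfl fun j _ => hd j _
  · intro i n hn
    refine (mem_row_deg p).2 fun j => ?_
    exact N.smul_mem hn (unit_mem p (i := j) (j := i₀) (SetLike.GradedOne.one_mem (A := A.deg))
        (by rw [h0]; ring))
  · intro m
    funext j
    refine Subtype.ext ?_
    change op (unit p j i₀ (1 : A)) •
      ∑ r, op (unit p i₀ r (1 : A)) • rowCornerEntry i₀ h0 N r m = _
    rw [Finset.smul_sum, Finset.sum_eq_single j]
    · rw [← mul_smul, ← op_mul, unit_mul_unit, one_mul]
      exact Subtype.property ((show ι → N.cornerSubmodule i₀ from m) j)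
    · intro r _ hr
      rw [← mul_smul, ← op_mul, unit_mul_unit_of_ne p _ _ hr, op_zero, zero_smul]
    · simp
  · intro n
    change (∑ j, op (unit p i₀ j (1 : A)) • op (unit p j i₀ (1 : A)) • n : N) = n
    simp only [← mul_smul, ← op_mul, unit_mul_unit, one_mul]
    rw [← Finset.sum_smul, ← Finset.op_sum, sum_unit_one, op_one, one_smul]

end CurvedModule

/-! ### Finitely generated twisted modules in terms of homogeneous bases. -/

namespace CurvedModule

open MulOpposite DGCategory

variable {k : Type u} [Field k] {A : CurvedAlgebra k}

/-- A family of homogeneous elements is a basis if every element is uniquely a combination of its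
members with coefficients in `A`. -/
def IsHomogeneousBasis (M : CurvedModule A) {I : Type} [Fintype I] (q : I → ℤ) (b : I → M) :
    Prop :=
  (∀ i, b i ∈ M.deg (q i)) ∧ Function.Bijective fun c : I → A => ∑ i, op (c i) • b i

/-- Bases of the graded pieces of `V` combine to a homogeneous basis, and the elements `v ⊗ 1` do
the rest. Indexing by `Fin n` moves the index set out of the universe of `V`. -/
theorem IsFGTwisted.exists_basis {M : CurvedModule A} (hM : M.IsFGTwisted) :
    ∃ (n : ℕ) (q : Fin n → ℤ) (b : Fin n → M), M.IsHomogeneousBasis q b := by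
  obtain ⟨V, _, _, degV, φ, _, hV, hφ, hdeg⟩ := hM
  let v := hV.collectedBasis fun i => Module.Basis.ofVectorSpace k (degV i)
  have : Finite (Σ i, Module.Basis.ofVectorSpaceIndex k (degV i)) := Module.Finite.finite_basis v
  let e := Finite.equivFin (Σ i, Module.Basis.ofVectorSpaceIndex k (degV i))
  refine ⟨_, fun i => (e.symm i).1, fun i => φ (v (e.symm i) ⊗ₜ 1), fun i => ?_, ?_⟩
  · have := hdeg (e.symm i).1 0 (v (e.symm i)) 1 (hV.collectedBasis_mem _ _)
      SetLike.GradedOne.one_mem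
    rwa [add_zero] at this
  · let ψ := (Finsupp.linearEquivFunOnFinite k A.carrier _).symm ≪≫ₗ
      (TensorProduct.equivFinsuppOfBasisLeft (N := A.carrier) (v.reindex e)).symm ≪≫ₗ φ
    convert ψ.bijective using 1
    funext c
    simp only [ψ, LinearEquiv.trans_apply, TensorProduct.equivFinsuppOfBasisLeft_symm_apply]
    rw [Finsupp.sum_fintype _ _ (by simp), map_sum]
    refine Finset.sum_congr rfl fun i _ => ?_
    rw [← hφ, one_mul, Module.Basis.reindex_apply]
    rfl

/-- Take `V = k^I` with the `i`-th coordinate vector in degree `q i`; the isomorphism sends `v ⊗ a`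
to the combination with coefficients `v i • a`. -/
theorem IsHomogeneousBasis.isFGTwisted {M : CurvedModule A} {I : Type} [Fintype I] {q : I → ℤ}
    {b : I → M} (hb : M.IsHomogeneousBasis q b) : M.IsFGTwisted := by
  classical
  let Ψ : (I → A) →ₗ[k] M := ∑ i,
    { toFun := fun c => op (c i) • b i
      map_add' := fun c c' => by rw [Pi.add_apply, op_add, add_smul]
      map_smul' := fun r c => by rw [Pi.smul_apply, op_smul, smul_assoc, RingHom.id_apply] }
  have hΨ : ∀ c, Ψ c = ∑ i, op (c i) • b i := fun c => by
    simp only [Ψ, LinearMap.sum_apply]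
    rfl
  let φ : TensorProduct k (I → k) A ≃ₗ[k] M :=
    TensorProduct.equivFinsuppOfBasisLeft (N := A.carrier) (Pi.basisFun k I) ≪≫ₗ
      Finsupp.linearEquivFunOnFinite k A.carrier I ≪≫ₗ
      LinearEquiv.ofBijective Ψ (by convert hb.2 using 1; exact funext hΨ)
  have hφ : ∀ (v : I → k) (a : A), φ (v ⊗ₜ a) = ∑ i, op (v i • a) • b i := fun v a => by
    simp only [φ, LinearEquiv.trans_apply, LinearEquiv.ofBijective_apply]
    rw [hΨ]
    refine Finset.sum_congr rfl fun i _ => ?_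
    simp
  let degV : ℤ → Submodule k (I → k) := fun n =>
    { carrier := {v | ∀ i, q i ≠ n → v i = 0}
      zero_mem' := fun _ _ => rfl
      add_mem' := fun {v w} hv hw i h => by rw [Pi.add_apply, hv i h, hw i h, add_zero]
      smul_mem' := fun c v hv i h => by rw [Pi.smul_apply, hv i h, smul_zero] }
  have hmem : ∀ {n : ℤ} {v : I → k}, v ∈ degV n ↔ ∀ i, q i ≠ n → v i = 0 := Iff.rfl
  refine ⟨I → k, inferInstance, inferInstance, degV, φ, inferInstance, ?_, ?_, ?_⟩
  · refine isInternal_of_projections _ (fun n => LinearMap.pi fun i =>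
      if q i = n then LinearMap.proj i else 0) ?_ ?_ ?_
    · intro n v hv
      funext i
      rw [LinearMap.pi_apply]
      split_ifs with h
      · rfl
      · exact (hmem.1 hv i h).symm
    · intro n l hnl v hv
      funext i
      rw [LinearMap.pi_apply]
      split_ifs with h
      · exact hmem.1 hv i (h ▸ hnl)
      · rfl
    · intro v
      rw [← Finset.univ_sum_single v]
      refine sum_mem fun i _ => Submodule.mem_iSup_of_mem (q i) (hmem.2 fun j hj => ?_)
      exact Pi.single_eq_of_ne (by rintro rfl; exact hj rfl) _
  · intro v a a'
    rw [hφ, hφ, Finset.smul_sum]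
    refine Finset.sum_congr rfl fun i _ => ?_
    rw [← mul_smul, ← op_mul, smul_mul_assoc]
  · intro i j v a hv ha
    rw [hφ]
    refine sum_mem fun l _ => ?_
    by_cases h : q l = i
    · have := M.smul_mem (hb.1 l) (Submodule.smul_mem _ (v l) ha)
      rwa [h] at this
    · rw [hmem.1 hv l h, zero_smul, op_zero, zero_smul]
      exact zero_mem _

variable {ι : Type} [Fintype ι] [DecidableEq ι] {p : ι → ℤ}

theorem mul_unit (b : A.matrixAlgebra p) (i j : ι) (a : A) :
    b * unit p i j a = ∑ l, unit p l j (A.toMatrix p b l i * a) := by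
  conv_lhs => rw [← sum_unit p b, Finset.sum_mul]
  refine Finset.sum_congr rfl fun l _ => ?_
  rw [Finset.sum_mul, Finset.sum_eq_single i]
  · exact unit_mul_unit p l i j _ _
  · intro r _ hr
    exact unit_mul_unit_of_ne p l j hr _ _
  · simp

theorem toMatrix_sum_unit (i₀ j : ι) (c : ι → A) :
    A.toMatrix p (∑ l, unit p l i₀ (c l)) j i₀ = c j := by
  rw [map_sum, Matrix.sum_apply, Finset.sum_eq_single j]
  · rw [unit, AlgEquiv.apply_symm_apply, Matrix.single_apply_same]
  · intro l _ hl
    rw [unit, AlgEquiv.apply_symm_apply, Matrix.single_apply_of_row_ne hl]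
  · simp

/-- The column `(A ⊗ End(V)) e` is free over `A` on the units `e_{j i₀}`, so a basis `b i` of `N`
yields the basis `b i e_{j i₀}` of `N e`, in degrees `q i + p j`. -/
theorem IsFGTwisted.corner {N : CurvedModule (A.matrixAlgebra p)} (hN : N.IsFGTwisted) (i₀ : ι)
    (h0 : p i₀ = 0) : (N.corner i₀ h0).IsFGTwisted := by
  obtain ⟨n, q, b, hdeg, hbij⟩ := hN.exists_basis
  let γ : (Fin n × ι → A) → Fin n → A.matrixAlgebra p := fun c i => ∑ j, unit p j i₀ (c (i, j))
  let b' : Fin n × ι → N.corner i₀ h0 := fun x =>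
    (⟨op (unit p x.2 i₀ 1) • b x.1, unit_smul_mem_corner i₀ _ _ _⟩ : N.cornerSubmodule i₀)
  have hval : ∀ c : Fin n × ι → A, (N.cornerSubmodule i₀).subtype (∑ x, op (c x) • b' x) =
      ∑ i, op (γ c i) • b i := by
    intro c
    refine (map_sum (N.cornerSubmodule i₀).subtype _ _).trans ?_
    rw [Fintype.sum_prod_type]
    refine Finset.sum_congr rfl fun i _ => ?_
    rw [Finset.op_sum, Finset.sum_smul]
    refine Finset.sum_congr rfl fun j _ => ?_
    change op (unit p i₀ i₀ (c (i, j))) • op (unit p j i₀ 1) • b i = _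
    rw [← mul_smul, ← op_mul, unit_mul_unit, one_mul]
  refine IsHomogeneousBasis.isFGTwisted (q := fun x => q x.1 + p x.2) (b := b') ⟨?_, ?_, ?_⟩
  · intro x
    exact N.smul_mem (hdeg x.1) (unit_mem p SetLike.GradedOne.one_mem (by rw [h0]; ring))
  · intro c c' h
    have h2 : γ c = γ c' := hbij.1 <| by
      change ∑ i, op (γ c i) • b i = ∑ i, op (γ c' i) • b i
      rw [← hval, ← hval]
      exact congrArg _ h
    funext x
    have h3 := congrArg (fun y => A.toMatrix p y x.2 i₀) (congrFun h2 x.1)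
    simp only [γ] at h3
    rwa [toMatrix_sum_unit i₀ x.2 (fun j => c (x.1, j)),
      toMatrix_sum_unit i₀ x.2 (fun j => c' (x.1, j))] at h3
  · rintro ⟨m, hm⟩
    obtain ⟨β, hβ⟩ := hbij.2 m
    -- Multiplying `m = m e` out, only column `i₀` of the coefficient matrices of `m` survives.
    refine ⟨fun x => A.toMatrix p (β x.1) x.2 i₀, Subtype.ext ?_⟩
    refine (hval _).trans ?_
    change _ = m
    rw [← (mem_corner i₀).1 hm, ← hβ, Finset.smul_sum]
    refine Finset.sum_congr rfl fun i _ => ?_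
    rw [← mul_smul, ← op_mul, mul_unit]
    simp only [γ, mul_one]

/-- The curved module `V ⊗ M` of column vectors with entries in `M`. -/
def column (p : ι → ℤ) (M : CurvedModule A) : CurvedModule A where
  carrier := ι → M
  isScalarTower := ⟨fun c a m => funext fun l => smul_assoc c a (m l)⟩
  deg := piDeg M (-p)
  decomposition := (isInternal_piDeg (-p) M).chooseDecomposition
  smul_mem := by
    intro i j m a hm ha
    rw [mem_piDeg] at hm ⊢
    intro l
    have := M.smul_mem (hm l) ha
    rwa [add_right_comm] at this
  d := LinearMap.pi fun i => (p i).negOnePow • M.d ∘ₗ LinearMap.proj i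
  d_mem := by
    intro i m hm
    rw [mem_piDeg] at hm ⊢
    intro l
    have := M.d_mem (hm l)
    rw [add_right_comm] at this
    exact (M.deg _).smul_of_tower_mem (p l).negOnePow this
  leibniz := by
    intro n m a hm
    rw [mem_piDeg] at hm
    funext l
    change (p l).negOnePow • M.d (op a • m l) =
      op a • (p l).negOnePow • M.d (m l) + n.negOnePow • op (A.d a) • m l
    -- Slot `l` has degree `n - p l`; the sign `(-1)^(p l)` in the differential of `column` restores
    -- `(-1)^n`.
    rw [M.leibniz a (hm l), Pi.neg_apply, Int.negOnePow_add, Int.negOnePow_neg, smul_add,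
      smul_comm (op a), smul_smul, mul_left_comm, Int.units_mul_self, mul_one]
  d_d := by
    intro m
    funext l
    change (p l).negOnePow • M.d ((p l).negOnePow • M.d (m l)) = -(op A.curv • m l)
    rw [LinearMap.map_smul_of_tower, smul_smul, Int.units_mul_self, one_smul, M.d_d]

/-- At `i₀` there is neither a shift nor a sign, so inclusion of and projection to that slot are
closed of degree `0`. -/
theorem isDirectSummand_column (M : CurvedModule A) {i₀ : ι} (h0 : p i₀ = 0) :
    IsDirectSummand k M (column p M) := by
  let s : homDeg M (column p M) 0 :=
    ⟨(LinearMap.single (A.carrier)ᵐᵒᵖ (fun _ : ι => M) i₀ : M →ₗ[(A.carrier)ᵐᵒᵖ] (ι → M)),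
      fun i m hm => single_mem_piDeg (-p) (by simpa [h0] using hm)⟩
  let r : homDeg (column p M) M 0 :=
    ⟨(LinearMap.proj i₀ : (ι → M) →ₗ[(A.carrier)ᵐᵒᵖ] M), fun i m hm => by
      have := (mem_piDeg (-p)).1 hm i₀
      rwa [Pi.neg_apply, h0, neg_zero] at this⟩
  refine ⟨s, r, (isClosedHom_iff s).1 fun m => funext fun l => ?_,
    (isClosedHom_iff r).1 fun (m : ι → M) => ?_, homDeg_ext fun m => ?_⟩
  · change (p l).negOnePow • M.d (Pi.single (M := fun _ => M) i₀ m l) =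
      Pi.single (M := fun _ => M) i₀ (M.d m) l
    by_cases h : l = i₀
    · subst h
      rw [Pi.single_eq_same, Pi.single_eq_same, h0, Int.negOnePow_zero, one_smul]
    · rw [Pi.single_eq_of_ne h, Pi.single_eq_of_ne h, map_zero, smul_zero]
  · change M.d (m i₀) = (p i₀).negOnePow • M.d (m i₀)
    rw [h0, Int.negOnePow_zero, one_smul]
  · exact Pi.single_eq_same (M := fun _ => M) i₀ m

/-- `V ⊗ M ⊗ V*` consists of the square matrices over `M`. A basis of `M` over `A`, placed as scalar
matrices, is a basis over matrices over `A`, with coefficients found entry by entry. Degrees are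
kept because the shifts `p j` and `-p j` cancel on the diagonal. -/
theorem IsFGTwisted.row_column {M : CurvedModule A} (hM : M.IsFGTwisted) :
    (row p (column p M)).IsFGTwisted := by
  obtain ⟨n, q, b, hdeg, hbij⟩ := hM.exists_basis
  let b' : Fin n → row p (column p M) := fun i =>
    (fun j => (Pi.single j (b i) : ι → M) : ι → ι → M)
  have hval : ∀ (c : Fin n → A.matrixAlgebra p) (l r : ι),
      ((∑ i, op (c i) • b' i : row p (column p M)) : ι → ι → M) l r =
        ∑ i, op (A.toMatrix p (c i) r l) • b i := by
    intro c l r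
    let ev : row p (column p M) →ₗ[k] M :=
      (LinearMap.proj r ∘ₗ LinearMap.proj l : (ι → ι → M) →ₗ[k] M)
    refine (map_sum ev (fun i => op (c i) • b' i) Finset.univ).trans ?_
    refine Finset.sum_congr rfl fun i _ => ?_
    change (∑ j, op (A.toMatrix p (c i) j l) • (Pi.single j (b i) : ι → M)) r = _
    rw [Finset.sum_apply, Finset.sum_eq_single r]
    · rw [Pi.smul_apply, Pi.single_eq_same]
    · intro j _ hj
      rw [Pi.smul_apply, Pi.single_eq_of_ne hj.symm, smul_zero]
    · simp
  refine IsHomogeneousBasis.isFGTwisted (q := q) (b := b') ⟨?_, ?_, ?_⟩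
  · intro i
    refine (mem_row_deg p).2 fun j => single_mem_piDeg (-p) ?_
    rw [Pi.neg_apply, add_neg_cancel_right]
    exact hdeg i
  · intro c c' h
    funext i
    apply (A.toMatrix p).injective
    ext r l
    refine congrFun (hbij.1 (?_ : ∑ i, op (A.toMatrix p (c i) r l) • b i =
      ∑ i, op (A.toMatrix p (c' i) r l) • b i)) i
    rw [← hval, ← hval]
    exact congrFun (congrFun h l) r
  · intro (y : ι → ι → M)
    choose c hc using hbij.2
    refine ⟨fun i => (A.toMatrix p).symm (Matrix.of fun r l => c (y l r) i), ?_⟩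
    funext l r
    refine (hval _ l r).trans ?_
    simp only [AlgEquiv.apply_symm_apply, Matrix.of_apply]
    exact hc (y l r)

end CurvedModule

/-! ### Assembly of the quasi-equivalence. -/

namespace CurvedModule

open DGCategory

/-- The dg categories `Perf^II` of a curved algebra and of a twist of its matrix algebra are
quasi-equivalent. -/
theorem exists_quasiEquivalence_twist_matrixAlgebra {k : Type u} [Field k] (A : CurvedAlgebra k)
    {ι : Type} [Fintype ι] [DecidableEq ι] (p : ι → ℤ) (i₀ : ι) (h0 : p i₀ = 0)
    (x : A.matrixAlgebra p) (hx : x ∈ (A.matrixAlgebra p).deg 1) :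
    ∃ F : DGFunctor k (PerfII A) (PerfII ((A.matrixAlgebra p).twist x hx)),
      F.IsQuasiEquivalence := by
  have : Nonempty ι := ⟨i₀⟩
  refine exists_quasiEquivalence_perfII ((twistFunctor x hx).comp (rowFunctor p))
    ((twistFunctor_fullyFaithful x hx).comp (rowFunctor_fullyFaithful p)) ?_ ?_ ?_ ?_
  · rintro M N f _ rfl
    exact rowMap_surjective_iff p f
  · intro N
    refine ⟨(N.untwist x hx).corner i₀ h0, ?_⟩
    have h := (twistFunctor x hx).map_closedIso (row_corner_closedIso i₀ h0 (N.untwist x hx))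
    have e : (twistFunctor x hx).obj (N.untwist x hx) = N := twist_untwist x hx N
    rwa [e] at h
  · intro T hT
    -- The row module of `T` need not be free; it is a summand of the row module of `column p T`,
    -- which is.
    exact ⟨(row p (column p T)).twist x hx, (isFGTwisted_twist x hx).2 hT.row_column,
      DGFunctor.map_isDirectSummand _ (isDirectSummand_column T h0)⟩
  · intro N hN
    refine ⟨(N.untwist x hx).corner i₀ h0,
      IsFGTwisted.corner ((isFGTwisted_untwist x hx).2 hN) i₀ h0, ?_⟩
    have h := (twistFunctor x hx).map_closedIso (row_corner_closedIso i₀ h0 (N.untwist x hx))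
    have e : (twistFunctor x hx).obj (N.untwist x hx) = N := twist_untwist x hx N
    rw [e] at h
    exact h.symm.isDirectSummand

end CurvedModule

end

theorem mainTheorem11 {k : Type u} [Field k] (A : CurvedAlgebra k) :
    A.uncurving.IsDG ∧
    (∃ F : DGFunctor k (PerfII A) (PerfII A.uncurving), F.IsQuasiEquivalence) ∧
    A.uncurving.IsAcyclic :=
  ⟨A.isDG_uncurving,
    -- The index `0` is the summand `k` of `k ⊕ k[1]`, whose basis vector has degree `0`;
    -- `A.uncurving` unfolds to the twist by `twistingElement`.
    CurvedModule.exists_quasiEquivalence_twist_matrixAlgebra A CurvedAlgebra.shiftDegrees 0 rfl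
      A.twistingElement A.twistingElement_mem,
    A.isAcyclic_uncurving⟩
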